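/- **Setting.** Let $0<d_0<p$ be fixed integers. For each $N$ there are $N$ independent observations $Z_i=(X_i,Y_i)\in\mathbb R^p\times\mathbb R$, split into $K=K_N$ sets $\mathcal S_1,\dots,\mathcal S_K$ (workers) of sizes $n_k=|\mathcal S_k|$; the observations in $\mathcal S_k$ have a common law $\nu_k$. Put $n=N/K$ and assume $c_1 n\le n_k\le c_2 n$ for positive constants $c_1,c_2$, and $n/\sqrt N\to\infty$. Let $\mathcal L(\theta;z)$ be a loss function, $\theta_0\in\mathbb R^p$ the true parameter, with $\theta_{0j}\ne0$ exactly for $j\in\mathcal M_T=\{1,\dots,d_0\}$, and $\mathcal L_k(\theta)=n_k^{-1}\sum_{i\in\mathcal S_k}\mathcal L(\theta;Z_i)$. Assume: (a) the parameter space $\Theta\subset\mathbb R^p$ is compact and convex, and $\theta_0$ lies in its interior; (b) for every $\delta>0$ there is $\varepsilon>0$ such that $P\{\mathcal L_k(\theta)-\mathcal L_k(\theta_0)\ge\varepsilon\text{ for all }k\le K\text{ and all }\theta\in\Theta\text{ with }\|\theta-\theta_0\|\ge\delta\}\to1$ as $N\to\infty$; and $E_{\nu_k}\{\partial_\theta\mathcal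 L(\theta_0;Z)\}=0$ for all $k$; (c) for every $k$ the matrices $\Omega_k=E_{\nu_k}\{\partial_\theta\mathcal L(\theta_0;Z)\,\partial_\theta\mathcal L(\theta_0;Z)^\top\}$ and $E_{\nu_k}\{\partial^2_\theta\mathcal L(\theta_0;Z)\}$ are finite and equal, and $\Omega_k$ is nonsingular; (d) for some $\delta>0$ and all $k$, for $\nu_k$-almost all $z$ the function $\mathcal L(\cdot;z)$ is three times differentiable at every $\theta\in\Theta$ with $\|\theta-\theta_0\|\le\delta$, and there $|\partial^3_{ijl}\mathcal L(\theta;z)|\le M_{ijl}(z)$, where $E_{\nu_k}M_{ijl}(Z)<\infty$ for all $i,j,l,k$; (e) if $K_N$ is unbounded, then moreover, uniformly in $k$, the eigenvalues of $\Omega_k$ are bounded and bounded away from $0$, and the second moments under $\nu_k$ of the entries of $\partial_\theta^2\mathcal L(\theta_0;Z)$ and of $M_{ijl}(Z)$ are bounded. **Estimators.** Let $\widehat\theta_k$ be a minimizer of $\mathcal L_k$ over $\Theta$, $\alpha_k=n_k/N$, $\widehat\Sigma_k^{-1}=n_k^{-1}\sum_{i\in\mathcal S_k}\partial^2_\theta\mathcal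 L(\widehat\theta_k;Z_i)$, $\widehat\Sigma^{-1}=\sum_k\alpha_k\widehat\Sigma_k^{-1}$, and $\widetilde\theta=(\sum_k\alpha_k\widehat\Sigma_k^{-1})^{-1}\sum_k\alpha_k\widehat\Sigma_k^{-1}\widehat\theta_k$. For $\lambda\in\mathbb R^p$ let $\widetilde\theta_\lambda$ be a minimizer over $\mathbb R^p$ of $Q_\lambda(\theta)=\sum_k\alpha_k(\theta-\widehat\theta_k)^\top\widehat\Sigma_k^{-1}(\theta-\widehat\theta_k)+\sum_j\lambda_j|\theta_j|$, let $\mathcal M_\lambda$ be the set of its nonzero coordinates, and $$\mathrm{DBIC}_\lambda=(\widetilde\theta_\lambda-\widetilde\theta)^\top\widehat\Sigma^{-1}(\widetilde\theta_\lambda-\widetilde\theta)+\frac{\log N}{N}\,|\mathcal M_\lambda| .$$ Let $\mathbb R_-=\{\lambda\in\mathbb R^p:\mathcal M_\lambda\not\supset\mathcal M_T\}$ (underfitted) and $\mathbb R_+=\{\lambda\in\mathbb R^p:\mathcal M_\lambda\supset\mathcal M_T,\ \mathcal M_\lambda\ne\mathcal M_T\}$ (overfitted). **Theorem.** Let $\lambda_N\in\mathbb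 R^p$ have its first $d_0$ entries equal to $1/N$ and its remaining entries equal to $\log N/\sqrt N$. Then $$P\Big(\inf_{\lambda\in\mathbb R_-\cup\mathbb R_+}\mathrm{DBIC}_\lambda>\mathrm{DBIC}_{\lambda_N}\Big)\to1\qquad(N\to\infty).$$ Hence DBIC selects the true model consistently: with probability tending to one, for every set $\Lambda\subset\mathbb R^p$ that contains $\lambda_N$, every minimizer $\lambda$ of $\mathrm{DBIC}$ over $\Lambda$ has $\mathcal M_\lambda=\mathcal M_T$. -/

import Mathlib

open MeasureTheory ProbabilityTheory Filter Topology
open scoped NNReal ENNReal Matrix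

noncomputable section

namespace DLSA

/-- The Euclidean space `ℝ^p`. -/
abbrev Vec (p : ℕ) : Type := EuclideanSpace ℝ (Fin p)

/-- An observation `Z = (X, Y)`: a covariate vector and a real response. -/
abbrev Obs (p : ℕ) : Type := Vec p × ℝ

/-- The `i`-th standard basis vector of `ℝ^p`. -/
def stdVec {p : ℕ} (i : Fin p) : Vec p := EuclideanSpace.single i (1 : ℝ)

/-! ### Partial derivatives of the loss in the parameter -/

section Loss

variable {p : ℕ} (loss : Vec p → Obs p → ℝ)

/-- `∂ℓ(θ; z) / ∂θ_i`. -/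
def dLoss (θ : Vec p) (z : Obs p) (i : Fin p) : ℝ :=
  fderiv ℝ (fun t => loss t z) θ (stdVec i)

/-- `∂²ℓ(θ; z) / ∂θ_i ∂θ_j`. -/
def d2Loss (θ : Vec p) (z : Obs p) (i j : Fin p) : ℝ :=
  fderiv ℝ (fderiv ℝ (fun t => loss t z)) θ (stdVec i) (stdVec j)

/-- `∂³ℓ(θ; z) / ∂θ_i ∂θ_j ∂θ_l`. -/
def d3Loss (θ : Vec p) (z : Obs p) (i j l : Fin p) : ℝ :=
  fderiv ℝ (fderiv ℝ (fderiv ℝ (fun t => loss t z))) θ (stdVec i) (stdVec j) (stdVec l)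

/-- The Hessian matrix of `ℓ(·; z)` at `θ`. -/
def hessLoss (θ : Vec p) (z : Obs p) : Matrix (Fin p) (Fin p) ℝ :=
  Matrix.of fun i j => d2Loss loss θ z i j

/-- `Ω(θ) = E {∂ℓ(θ; Z)/∂θ · ∂ℓ(θ; Z)/∂θᵀ}` for an observation `Z` of law `ν`. -/
def infoMatrix (ν : Measure (Obs p)) (θ : Vec p) : Matrix (Fin p) (Fin p) ℝ :=
  Matrix.of fun i j => ∫ z, dLoss loss θ z i * dLoss loss θ z j ∂ν

end Loss

/-! ### Workers, local losses, and the estimators computed from one data set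

`N` observations `z` are split over `K` workers by the assignment `w`. -/

section Sample

variable {p N K : ℕ} (loss : Vec p → Obs p → ℝ) (w : Fin N → Fin K) (z : Fin N → Obs p)

/-- `S_k`: the observations held by the `k`-th worker. -/
def workerSet (k : Fin K) : Finset (Fin N) := Finset.univ.filter fun i => w i = k

/-- `n_k = |S_k|`. -/
def workerSize (k : Fin K) : ℕ := (workerSet w k).card

/-- `α_k = n_k / N`. -/
def workerWeight (k : Fin K) : ℝ := (workerSize w k : ℝ) / N

/-- `L_k(θ) = n_k⁻¹ ∑_{i ∈ S_k} ℓ(θ; z_i)`. -/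
def localLoss (k : Fin K) (θ : Vec p) : ℝ :=
  (workerSize w k : ℝ)⁻¹ * ∑ i ∈ workerSet w k, loss θ (z i)

/-- `n_k⁻¹ ∑_{i ∈ S_k} ∂²ℓ(θ; z_i)/∂θ∂θᵀ`. At `θ = θhat_k` this is `Σhat_k⁻¹`. -/
def localHess (k : Fin K) (θ : Vec p) : Matrix (Fin p) (Fin p) ℝ :=
  (workerSize w k : ℝ)⁻¹ • ∑ i ∈ workerSet w k, hessLoss loss θ (z i)

variable (θhat : Fin K → Vec p)

/-- `Σhat⁻¹ = ∑_k α_k Σhat_k⁻¹`. -/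
def precision : Matrix (Fin p) (Fin p) ℝ :=
  ∑ k, workerWeight w k • localHess loss w z k (θhat k)

/-- The quadratic form `vᵀ A v`. -/
def quadForm (A : Matrix (Fin p) (Fin p) ℝ) (v : Vec p) : ℝ := v.ofLp ⬝ᵥ (A *ᵥ v.ofLp)

/-- The weighted least squares estimator
`(∑_k α_k Σhat_k⁻¹)⁻¹ (∑_k α_k Σhat_k⁻¹ θhat_k)`. -/
def wlse : Vec p :=
  WithLp.toLp 2 ((precision loss w z θhat)⁻¹ *ᵥ
    ∑ k, workerWeight w k • (localHess loss w z k (θhat k) *ᵥ (θhat k).ofLp))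

/-- The weighted least squares objective `∑_k (θ - θhat_k)ᵀ α_k Σhat_k⁻¹ (θ - θhat_k)`. -/
def lsLoss (θ : Vec p) : ℝ :=
  ∑ k, workerWeight w k * quadForm (localHess loss w z k (θhat k)) (θ - θhat k)

/-- The adaptive Lasso objective `Q_lam(θ)`. -/
def lassoObj (lam : Fin p → ℝ) (θ : Vec p) : ℝ :=
  lsLoss loss w z θhat θ + ∑ j, lam j * |θ j|

/-- The set of the nonzero coordinates of a vector. -/
def model (θ : Vec p) : Finset (Fin p) := Finset.univ.filter fun j => θ j ≠ 0

/-- The criterion at an estimate `θ`: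
`(θ - θtilde)ᵀ Σhat⁻¹ (θ - θtilde) + log N × df / N`, where `θtilde` is the weighted least
squares estimator and `df` is the number of nonzero coordinates of `θ`. -/
def dbic (θ : Vec p) : ℝ :=
  quadForm (precision loss w z θhat) (θ - wlse loss w z θhat)
    + Real.log N * ((model θ).card : ℝ) / N

end Sample

/-- The true model: the first `d₀` coordinates. -/
def trueModel (p d₀ : ℕ) : Finset (Fin p) := Finset.univ.filter fun j => (j : ℕ) < d₀

/-- The reference tuning parameter: `1/N` on the true model and `log N / √N` off it. -/
def refTuning (p d₀ N : ℕ) : Fin p → ℝ :=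
  fun j => if (j : ℕ) < d₀ then 1 / (N : ℝ) else Real.log N / Real.sqrt N

/-- The tuning parameters that give an underfitted model, where `est lam` is the shrinkage
estimate at the tuning parameter `lam`. -/
def underfitted {p : ℕ} (d₀ : ℕ) (est : (Fin p → ℝ) → Vec p) : Set (Fin p → ℝ) :=
  {lam | ¬ trueModel p d₀ ⊆ model (est lam)}

/-- The tuning parameters that give an overfitted model. -/
def overfitted {p : ℕ} (d₀ : ℕ) (est : (Fin p → ℝ) → Vec p) : Set (Fin p → ℝ) :=
  {lam | trueModel p d₀ ⊆ model (est lam) ∧ model (est lam) ≠ trueModel p d₀}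

/-- The events `A N` have probability tending to one. It is written through the complements, so
that for an event that is not measurable it is the inner probability that tends to one. -/
def HighProb {Ω : Type*} [MeasurableSpace Ω] (P : Measure Ω) (A : ℕ → Ω → Prop) : Prop :=
  Tendsto (fun N => P {ω | ¬ A N ω}) atTop (𝓝 0)

/-! ### The conditions -/

/-- The split of the sample: the worker sizes are of the order of `n = N / K`, and
`n / √N → ∞`. -/
def CondWorkers (K : ℕ → ℕ) (w : (N : ℕ) → Fin N → Fin (K N)) : Prop :=
  (∃ c₁ c₂ : ℝ, 0 < c₁ ∧ ∀ (N : ℕ) (k : Fin (K N)),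
    c₁ * ((N : ℝ) / K N) ≤ workerSize (w N) k ∧ (workerSize (w N) k : ℝ) ≤ c₂ * ((N : ℝ) / K N)) ∧
  Tendsto (fun N : ℕ => ((N : ℝ) / K N) / Real.sqrt N) atTop atTop

/-- Parameter space. -/
def CondParameterSpace {p : ℕ} (Θ : Set (Vec p)) (θ₀ : Vec p) : Prop :=
  IsCompact Θ ∧ Convex ℝ Θ ∧ θ₀ ∈ interior Θ

/-- Sampling: at each stage the observations are independent, and those of the `k`-th worker have
the common law `ν k`. The covariate distribution of the worker is the first marginal of `ν k`. -/
def CondSampling {p : ℕ} {Ω : Type*} [MeasurableSpace Ω] (P : Measure Ω) (K : ℕ → ℕ)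
    (w : (N : ℕ) → Fin N → Fin (K N)) (Z : (N : ℕ) → Fin N → Ω → Obs p)
    (ν : ℕ → Measure (Obs p)) : Prop :=
  ∀ N, iIndepFun (Z N) P ∧ ∀ i, HasLaw (Z N i) (ν (w N i)) P

/-- Identifiability. -/
def CondIdentifiable {p : ℕ} {Ω : Type*} [MeasurableSpace Ω] (P : Measure Ω) (K : ℕ → ℕ)
    (w : (N : ℕ) → Fin N → Fin (K N)) (Z : (N : ℕ) → Fin N → Ω → Obs p)
    (ν : ℕ → Measure (Obs p)) (loss : Vec p → Obs p → ℝ) (Θ : Set (Vec p)) (θ₀ : Vec p) : Prop :=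
  (∀ δ > 0, ∃ ε > 0, HighProb P fun N ω => ∀ k : Fin (K N), ∀ θ ∈ Θ, δ ≤ ‖θ - θ₀‖ →
    ε ≤ localLoss loss (w N) (fun i => Z N i ω) k θ - localLoss loss (w N) (fun i => Z N i ω) k θ₀) ∧
  ∀ (k : ℕ) (i : Fin p), Integrable (fun z => dLoss loss θ₀ z i) (ν k) ∧
    ∫ z, dLoss loss θ₀ z i ∂ν k = 0

/-- Local convexity: the two expressions of the information matrix at the true value are finite
and agree, and the matrix is nonsingular. -/
def CondLocalConvexity {p : ℕ} (ν : ℕ → Measure (Obs p)) (loss : Vec p → Obs p → ℝ)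
    (θ₀ : Vec p) : Prop :=
  ∀ k : ℕ, (∀ i, MemLp (fun z => dLoss loss θ₀ z i) 2 (ν k)) ∧
    (∀ i j, Integrable (fun z => d2Loss loss θ₀ z i j) (ν k)) ∧
    (∀ i j, infoMatrix loss (ν k) θ₀ i j = ∫ z, d2Loss loss θ₀ z i j ∂ν k) ∧
    IsUnit (infoMatrix loss (ν k) θ₀)

/-- Smoothness: near the true value the loss has third derivatives, dominated by the integrable
functions `M i j l`. -/
def CondSmooth {p : ℕ} (ν : ℕ → Measure (Obs p)) (loss : Vec p → Obs p → ℝ) (Θ : Set (Vec p))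
    (θ₀ : Vec p) (M : Fin p → Fin p → Fin p → Obs p → ℝ) : Prop :=
  (∃ δ > 0, ∀ k : ℕ, ∀ᵐ z ∂ν k, ∀ θ ∈ Θ, ‖θ - θ₀‖ ≤ δ →
    DifferentiableAt ℝ (fun t => loss t z) θ ∧
    DifferentiableAt ℝ (fderiv ℝ (fun t => loss t z)) θ ∧
    DifferentiableAt ℝ (fderiv ℝ (fderiv ℝ (fun t => loss t z))) θ ∧
    ∀ i j l, |d3Loss loss θ z i j l| ≤ M i j l z) ∧
  ∀ (k : ℕ) (i j l : Fin p), Integrable (M i j l) (ν k)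

/-- Uniformity over the workers, which says something only when the number of workers is
unbounded: the information matrices are bounded and bounded away from singularity, and the
second derivatives at the true value and the dominating functions have bounded second moments. -/
def CondUniform {p : ℕ} (K : ℕ → ℕ) (ν : ℕ → Measure (Obs p)) (loss : Vec p → Obs p → ℝ)
    (θ₀ : Vec p) (M : Fin p → Fin p → Fin p → Obs p → ℝ) : Prop :=
  (∃ K₀ : ℕ, ∀ N, K N ≤ K₀) ∨
  ∃ (c : ℝ) (C : ℝ≥0), 0 < c ∧ ∀ k : ℕ,
    (∀ v : Vec p, c * ‖v‖ ^ 2 ≤ quadForm (infoMatrix loss (ν k) θ₀) v) ∧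
    (∀ v : Vec p, quadForm (infoMatrix loss (ν k) θ₀) v ≤ C * ‖v‖ ^ 2) ∧
    (∀ i j, eLpNorm (fun z => d2Loss loss θ₀ z i j) 2 (ν k) ≤ C) ∧
    (∀ i j l, eLpNorm (M i j l) 2 (ν k) ≤ C)

end DLSA

end

namespace DLSA

/-! ### Bilinear forms and coordinates -/

/-! Put r = √(log N / N). The deterministic threshold r²(d₀ + 1) separates the two sides: with
probability tending to one, the criterion at the reference estimate lies below it, while at every
vector with a wrong model it lies at or above it. The second bound concerns all vectors rather than
lasso estimates, so uniformity in the tuning parameter costs nothing, and negative tuning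
parameters, for which no minimizer may exist, do no harm.

Two facts about the weighted least squares estimator θ̃ suffice (`exists_highProb_wlse`): the matrix
Σ̂⁻¹ is symmetric and has its quadratic form between fixed positive multiples of ‖v‖², and ‖θ̃ - θ₀‖
= o(r). An overfitted model pays at least r²(d₀ + 1) through the penalty alone. An underfitted one
has a zero where θ₀ has none, so its distance to θ̃ stays away from zero, and so does its quadratic
term, whereas r → 0 (`dbic_ge_of_model_ne`). For the reference tuning, comparison with θ₀ bounds the
quadratic term by r²/2, and the penalty log N / √N = √(log N) · r exceeds the O(r) slope of the
quadratic off the true model, so those coordinates vanish and the criterion is at most r²(d₀ + 1/2)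
(`dbic_le_of_isMinOn_refTuning`).

The rate of θ̃ comes from expanding each local score about θ̂_k: Σ̂_k⁻¹(θ̂_k - θ₀) is minus the
local score at θ₀, up to O(‖θ̂_k - θ₀‖²). Weighted by α_k, the local scores add up to the score of
the whole sample, of order N^(-1/2). The remainders are controlled by the weighted squares of the
local scores, of order K/N, which n/√N → ∞ makes o(N^(-1/2)) (`norm_wlse_sub_le`). Uniform control
of the local Hessians comes from a union bound over the workers. -/

lemma sum_smul_stdVec {p : ℕ} (v : Vec p) : v = ∑ i, v i • stdVec i := by
  ext j
  simp [stdVec, Pi.single_apply]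

lemma norm_coord_le {p : ℕ} (v : Vec p) (i : Fin p) : |v i| ≤ ‖v‖ := by
  simpa using PiLp.norm_apply_le v i

/-- The bilinear form `uᵀ A v`. -/
def bil {p : ℕ} (A : Matrix (Fin p) (Fin p) ℝ) (u v : Vec p) : ℝ := u.ofLp ⬝ᵥ (A *ᵥ v.ofLp)

lemma quadForm_eq_bil {p : ℕ} (A : Matrix (Fin p) (Fin p) ℝ) (v : Vec p) :
    quadForm A v = bil A v v := rfl

section Bil

variable {p : ℕ} (A B : Matrix (Fin p) (Fin p) ℝ) (u v x : Vec p)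

lemma bil_eq_sum : bil A u v = ∑ i, ∑ j, u i * (A i j * v j) := by
  simp [bil, dotProduct, Matrix.mulVec, Finset.mul_sum]

lemma bil_add_left : bil A (u + x) v = bil A u v + bil A x v := by simp [bil, add_dotProduct]

lemma bil_sub_left : bil A (u - x) v = bil A u v - bil A x v := by simp [bil, sub_dotProduct]

lemma bil_add_right : bil A u (v + x) = bil A u v + bil A u x := by
  simp [bil, Matrix.mulVec_add, dotProduct_add]

lemma bil_sub_right : bil A u (v - x) = bil A u v - bil A u x := by
  simp [bil, Matrix.mulVec_sub, dotProduct_sub]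

lemma bil_smul_left (t : ℝ) : bil A (t • u) v = t * bil A u v := by simp [bil]

lemma bil_smul_right (t : ℝ) : bil A u (t • v) = t * bil A u v := by
  simp [bil, Matrix.mulVec_smul]

lemma bil_sub_matrix : bil (A - B) u v = bil A u v - bil B u v := by
  simp [bil, Matrix.sub_mulVec, dotProduct_sub]

lemma bil_smul_matrix (t : ℝ) : bil (t • A) u v = t * bil A u v := by
  simp [bil, Matrix.smul_mulVec]

lemma bil_sum_matrix {ι : Type*} (s : Finset ι) (F : ι → Matrix (Fin p) (Fin p) ℝ) :
    bil (∑ i ∈ s, F i) u v = ∑ i ∈ s, bil (F i) u v := by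
  simp [bil, Matrix.sum_mulVec, dotProduct_sum]

lemma abs_bil_le {e : ℝ} (h : ∀ i j, |A i j| ≤ e) : |bil A u v| ≤ (p : ℝ) ^ 2 * e * ‖u‖ * ‖v‖ := by
  rw [bil_eq_sum]
  calc |∑ i, ∑ j, u i * (A i j * v j)| ≤ ∑ i : Fin p, ∑ j : Fin p, ‖u‖ * (e * ‖v‖) := by
        refine (Finset.abs_sum_le_sum_abs _ _).trans (Finset.sum_le_sum fun i _ => ?_)
        refine (Finset.abs_sum_le_sum_abs _ _).trans (Finset.sum_le_sum fun j _ => ?_)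
        rw [abs_mul, abs_mul]
        have := (abs_nonneg _).trans (h i j)
        gcongr
        · exact norm_coord_le u i
        · exact h i j
        · exact norm_coord_le v j
    _ = (p : ℝ) ^ 2 * e * ‖u‖ * ‖v‖ := by simp; ring

lemma continuous_quadForm : Continuous (quadForm A) := by
  unfold quadForm
  simp only [dotProduct, Matrix.mulVec]
  fun_prop

end Bil

/-- The Hessian matrix represents the second derivative. -/
lemma bil_hessLoss {p : ℕ} (loss : Vec p → Obs p → ℝ) (θ : Vec p) (z : Obs p) (u v : Vec p) :
    bil (hessLoss loss θ z) u v = fderiv ℝ (fderiv ℝ (fun t => loss t z)) θ u v := by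
  conv_rhs => rw [sum_smul_stdVec u, sum_smul_stdVec v]
  simp only [map_sum, map_smul, FunLike.coe_sum, FunLike.coe_smul,
    Finset.sum_apply, Pi.smul_apply, smul_eq_mul, Finset.mul_sum]
  rw [bil_eq_sum]
  simp only [hessLoss, d2Loss, Matrix.of_apply]
  rw [Finset.sum_comm]
  refine Finset.sum_congr rfl fun i _ => Finset.sum_congr rfl fun j _ => by ring

lemma fderiv_eq_sum_dLoss {p : ℕ} (loss : Vec p → Obs p → ℝ) (θ : Vec p) (z : Obs p) (v : Vec p) :
    fderiv ℝ (fun t => loss t z) θ v = ∑ i, v i * dLoss loss θ z i := by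
  conv_lhs => rw [sum_smul_stdVec v]
  simp [dLoss]

/-! ### Taylor bounds for a function with bounded third derivatives -/

-- Turns the entrywise domination of the third derivatives into an operator norm bound, the form
-- that the mean value inequality needs.
set_option maxSynthPendingDepth 3 in
lemma norm_trilinear_le {p : ℕ} (T : Vec p →L[ℝ] Vec p →L[ℝ] Vec p →L[ℝ] ℝ)
    (m : Fin p → Fin p → Fin p → ℝ) (h : ∀ i j l, |T (stdVec i) (stdVec j) (stdVec l)| ≤ m i j l) :
    ‖T‖ ≤ ∑ i, ∑ j, ∑ l, m i j l := by
  have hm : ∀ i j l, 0 ≤ m i j l := fun i j l => (abs_nonneg _).trans (h i j l)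
  have h0 : 0 ≤ ∑ i, ∑ j, ∑ l, m i j l :=
    Finset.sum_nonneg fun i _ => Finset.sum_nonneg fun j _ => Finset.sum_nonneg fun l _ => hm i j l
  refine T.opNorm_le_bound h0 fun u => ?_
  refine (T u).opNorm_le_bound (by positivity) fun v => ?_
  refine (T u v).opNorm_le_bound (by positivity) fun x => ?_
  have e : T u v x = ∑ i, ∑ j, ∑ l, u i * (v j * (x l * T (stdVec i) (stdVec j) (stdVec l))) := by
    have e1 : ∀ a b, T a b x = ∑ l, x l * T a b (stdVec l) := fun a b => by
      conv_lhs => rw [sum_smul_stdVec x]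
      simp
    have e2 : ∀ a, T a v x = ∑ j, v j * T a (stdVec j) x := fun a => by
      conv_lhs => rw [sum_smul_stdVec v]
      simp
    have e3 : T u v x = ∑ i, u i * T (stdVec i) v x := by
      conv_lhs => rw [sum_smul_stdVec u]
      simp
    rw [e3]
    refine Finset.sum_congr rfl fun i _ => ?_
    rw [e2, Finset.mul_sum]
    refine Finset.sum_congr rfl fun j _ => ?_
    rw [e1, Finset.mul_sum, Finset.mul_sum]
  rw [e, Finset.sum_mul, Finset.sum_mul, Finset.sum_mul, Real.norm_eq_abs]
  refine (Finset.abs_sum_le_sum_abs _ _).trans (Finset.sum_le_sum fun i _ => ?_)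
  rw [Finset.sum_mul, Finset.sum_mul, Finset.sum_mul]
  refine (Finset.abs_sum_le_sum_abs _ _).trans (Finset.sum_le_sum fun j _ => ?_)
  rw [Finset.sum_mul, Finset.sum_mul, Finset.sum_mul]
  refine (Finset.abs_sum_le_sum_abs _ _).trans (Finset.sum_le_sum fun l _ => ?_)
  rw [abs_mul, abs_mul, abs_mul]
  have h1 := hm i j l
  calc |u i| * (|v j| * (|x l| * |T (stdVec i) (stdVec j) (stdVec l)|))
      ≤ ‖u‖ * (‖v‖ * (‖x‖ * m i j l)) := by
        gcongr
        · exact norm_coord_le u i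
        · exact norm_coord_le v j
        · exact norm_coord_le x l
        · exact h i j l
    _ = m i j l * ‖u‖ * ‖v‖ * ‖x‖ := by ring

section Taylor

variable {E : Type*} [NormedAddCommGroup E] [NormedSpace ℝ E] {f : E → ℝ} {a θ : E} {δ m : ℝ}

set_option maxSynthPendingDepth 3 in
lemma norm_fderiv_fderiv_sub_le
    (h3 : ∀ θ ∈ Metric.ball a δ, DifferentiableAt ℝ (fderiv ℝ (fderiv ℝ f)) θ)
    (hm : ∀ θ ∈ Metric.ball a δ, ‖fderiv ℝ (fderiv ℝ (fderiv ℝ f)) θ‖ ≤ m)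
    {x y : E} (hx : x ∈ Metric.ball a δ) (hy : y ∈ Metric.ball a δ) :
    ‖fderiv ℝ (fderiv ℝ f) y - fderiv ℝ (fderiv ℝ f) x‖ ≤ m * ‖y - x‖ :=
  (convex_ball a δ).norm_image_sub_le_of_norm_fderiv_le h3 hm hx hy

-- The expansion is based at `θ`, not at the centre `a`, because the precision matrices are Hessians
-- at the estimates. Along the segment the Hessian moves by at most `m * ‖θ - a‖`; the mean value
-- inequality then gives the square, without the factor 1/2 of the integral remainder.
set_option maxSynthPendingDepth 3 in
lemma norm_fderiv_taylor_le
    (h2 : ∀ θ ∈ Metric.ball a δ, DifferentiableAt ℝ (fderiv ℝ f) θ)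
    (h3 : ∀ θ ∈ Metric.ball a δ, DifferentiableAt ℝ (fderiv ℝ (fderiv ℝ f)) θ)
    (hm : ∀ θ ∈ Metric.ball a δ, ‖fderiv ℝ (fderiv ℝ (fderiv ℝ f)) θ‖ ≤ m)
    (hθ : θ ∈ Metric.ball a δ) :
    ‖fderiv ℝ f a - fderiv ℝ f θ - fderiv ℝ (fderiv ℝ f) θ (a - θ)‖ ≤ m * ‖θ - a‖ ^ 2 := by
  have hδ : 0 < δ := dist_nonneg.trans_lt hθ
  have ha : a ∈ Metric.ball a δ := Metric.mem_ball_self hδ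
  have hm0 : 0 ≤ m := (norm_nonneg _).trans (hm a ha)
  have hseg : segment ℝ θ a ⊆ Metric.ball a δ := (convex_ball a δ).segment_subset hθ ha
  have := (convex_segment θ a).norm_image_sub_le_of_norm_fderiv_le'
    (f := fderiv ℝ f) (φ := fderiv ℝ (fderiv ℝ f) θ) (C := m * ‖θ - a‖)
    (fun x hx => h2 x (hseg hx)) (fun x hx => ?_) (left_mem_segment ℝ θ a)
    (right_mem_segment ℝ θ a)
  · rw [norm_sub_rev a θ] at this
    rw [pow_two, ← mul_assoc]; exact this
  · refine (norm_fderiv_fderiv_sub_le h3 hm hθ (hseg hx)).trans ?_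
    gcongr
    obtain ⟨s, t, hs, ht, hst, rfl⟩ := hx
    have : s • θ + t • a - θ = t • (a - θ) := by
      rw [show s = 1 - t by linarith]; module
    rw [this, norm_smul, norm_sub_rev a θ, Real.norm_of_nonneg ht]
    exact mul_le_of_le_one_left (norm_nonneg _) (by linarith)

lemma fderiv_fderiv_symm (h1 : ∀ θ ∈ Metric.ball a δ, DifferentiableAt ℝ f θ)
    (h2 : ∀ θ ∈ Metric.ball a δ, DifferentiableAt ℝ (fderiv ℝ f) θ)
    (hθ : θ ∈ Metric.ball a δ) (u v : E) :
    fderiv ℝ (fderiv ℝ f) θ u v = fderiv ℝ (fderiv ℝ f) θ v u := by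
  refine second_derivative_symmetric_of_eventually (f := f) (f' := fderiv ℝ f) (𝕜 := ℝ) ?_
    (h2 θ hθ).hasFDerivAt u v
  filter_upwards [Metric.isOpen_ball.mem_nhds hθ] with y hy using (h1 y hy).hasFDerivAt

end Taylor

/-! ### Events of probability tending to one -/

section HighProb

variable {Ω : Type*} [MeasurableSpace Ω] {P : Measure Ω} {A B : ℕ → Ω → Prop}

/-- The inclusion is asked for only almost surely and for large `N`, since smoothness and the
minimizing properties hold almost surely and the rates are asymptotic. -/
lemma HighProb.mono (hA : HighProb P A) (h : ∀ᶠ N in atTop, ∀ᵐ ω ∂P, A N ω → B N ω) :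
    HighProb P B := by
  refine tendsto_of_tendsto_of_tendsto_of_le_of_le' tendsto_const_nhds hA
    (Eventually.of_forall fun _ => zero_le) ?_
  filter_upwards [h] with N hN
  refine measure_mono_ae ?_
  filter_upwards [hN] with ω hω
  exact fun hb ha => hb (hω ha)

lemma HighProb.and (hA : HighProb P A) (hB : HighProb P B) :
    HighProb P fun N ω => A N ω ∧ B N ω := by
  have hs : Tendsto (fun N => P {ω | ¬ A N ω} + P {ω | ¬ B N ω}) atTop (𝓝 0) := by
    simpa using hA.add hB
  refine tendsto_of_tendsto_of_tendsto_of_le_of_le tendsto_const_nhds hs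
    (fun _ => zero_le) fun N => ?_
  refine (measure_mono fun ω hω => ?_).trans (measure_union_le _ _)
  simp only [Set.mem_ofPred_eq, Set.mem_union] at hω ⊢
  tauto

lemma highProb_forall {ι : Type*} [Fintype ι] {A : ι → ℕ → Ω → Prop}
    (h : ∀ i, HighProb P (A i)) : HighProb P fun N ω => ∀ i, A i N ω := by
  have hs : Tendsto (fun N => ∑ i, P {ω | ¬ A i N ω}) atTop (𝓝 0) := by
    simpa using tendsto_finsetSum Finset.univ fun i _ => h i
  refine tendsto_of_tendsto_of_tendsto_of_le_of_le tendsto_const_nhds hs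
    (fun _ => zero_le) fun N => ?_
  refine le_trans (measure_mono fun ω hω => ?_) (measure_iUnion_fintype_le _ _)
  simpa using hω

lemma highProb_of_le_ofReal {u : ℕ → ℝ} (hu : Tendsto u atTop (𝓝 0))
    (h : ∀ᶠ N in atTop, P {ω | ¬ A N ω} ≤ ENNReal.ofReal (u N)) : HighProb P A := by
  have hs : Tendsto (fun N => ENNReal.ofReal (u N)) atTop (𝓝 0) := by
    simpa using ENNReal.tendsto_ofReal hu
  exact tendsto_of_tendsto_of_tendsto_of_le_of_le' tendsto_const_nhds hs
    (Eventually.of_forall fun _ => zero_le) h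

end HighProb

/-! ### Sums of independent variables -/

section Sums

variable {Ω S ι : Type*} [MeasurableSpace Ω] [MeasurableSpace S] {P : Measure Ω}
  {Z : ι → Ω → S} {μ : ι → Measure S} {f : S → ℝ} {s : Finset ι}

lemma _root_.ProbabilityTheory.HasLaw.memLp_comp {X : Ω → S} {ν : Measure S} {q : ℝ≥0∞}
    (hX : HasLaw X ν P) (hf : MemLp f q ν) : MemLp (fun ω => f (X ω)) q P := by
  have h := hX.map_eq ▸ hf
  exact h.comp_of_map hX.aemeasurable

lemma _root_.ProbabilityTheory.HasLaw.integral_comp' {X : Ω → S} {ν : Measure S}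
    (hX : HasLaw X ν P) (hf : AEStronglyMeasurable f ν) :
    ∫ ω, f (X ω) ∂P = ∫ x, f x ∂ν := hX.integral_comp hf

lemma variance_sum_comp_le [IsProbabilityMeasure P] (hind : iIndepFun Z P)
    (hlaw : ∀ i ∈ s, HasLaw (Z i) (μ i) P) (hf : ∀ i ∈ s, MemLp f 2 (μ i)) :
    variance (fun ω => ∑ i ∈ s, f (Z i ω)) P ≤ ∑ i ∈ s, ∫ x, f x ^ 2 ∂μ i := by
  have hL : ∀ i ∈ s, MemLp (fun ω => f (Z i ω)) 2 P := fun i hi =>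
    (hlaw i hi).memLp_comp (hf i hi)
  have e : (fun ω => ∑ i ∈ s, f (Z i ω)) = ∑ i ∈ s, fun ω => f (Z i ω) := by
    ext ω; simp
  rw [e, IndepFun.variance_sum hL]
  · refine Finset.sum_le_sum fun i hi => ?_
    refine (variance_le_expectation_sq (hL i hi).aestronglyMeasurable).trans_eq ?_
    exact (hlaw i hi).integral_comp' ((hf i hi).aestronglyMeasurable.pow 2)
  · intro i hi j hj hij
    refine (hind.indepFun hij).comp₀ (hlaw i hi).aemeasurable (hlaw j hj).aemeasurable ?_ ?_
    · rw [(hlaw i hi).map_eq]; exact (hf i hi).aestronglyMeasurable.aemeasurable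
    · rw [(hlaw j hj).map_eq]; exact (hf j hj).aestronglyMeasurable.aemeasurable

/-- The second moment of a sum of independent centred variables. -/
lemma integral_sq_sum_comp_le [IsProbabilityMeasure P] (hind : iIndepFun Z P)
    (hlaw : ∀ i ∈ s, HasLaw (Z i) (μ i) P) (hf : ∀ i ∈ s, MemLp f 2 (μ i))
    (h0 : ∀ i ∈ s, ∫ x, f x ∂μ i = 0) :
    ∫ ω, (∑ i ∈ s, f (Z i ω)) ^ 2 ∂P ≤ ∑ i ∈ s, ∫ x, f x ^ 2 ∂μ i := by
  have hL : ∀ i ∈ s, MemLp (fun ω => f (Z i ω)) 2 P := fun i hi =>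
    (hlaw i hi).memLp_comp (hf i hi)
  refine le_trans (le_of_eq ?_) (variance_sum_comp_le hind hlaw hf)
  rw [variance_of_integral_eq_zero]
  · exact (memLp_finsetSum s hL).aestronglyMeasurable.aemeasurable
  · rw [integral_finsetSum s fun i hi => (hL i hi).integrable one_le_two]
    refine Finset.sum_eq_zero fun i hi => ?_
    rw [(hlaw i hi).integral_comp' (hf i hi).aestronglyMeasurable, h0 i hi]

lemma integrable_sq_sum_comp (hlaw : ∀ i ∈ s, HasLaw (Z i) (μ i) P)
    (hf : ∀ i ∈ s, MemLp f 2 (μ i)) : Integrable (fun ω => (∑ i ∈ s, f (Z i ω)) ^ 2) P :=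
  (memLp_finsetSum s fun i hi => (hlaw i hi).memLp_comp (hf i hi)).integrable_sq

variable {ν : Measure S}

/-- Chebyshev's inequality for an empirical mean. -/
lemma meas_empirical_sub_ge_le [IsProbabilityMeasure P] (hind : iIndepFun Z P)
    (hlaw : ∀ i ∈ s, HasLaw (Z i) ν P) (hf : MemLp f 2 ν) (hs : 0 < s.card) {ε : ℝ} (hε : 0 < ε) :
    P {ω | ε ≤ |(s.card : ℝ)⁻¹ * ∑ i ∈ s, f (Z i ω) - ∫ x, f x ∂ν|} ≤
      ENNReal.ofReal ((∫ x, f x ^ 2 ∂ν) / (s.card * ε ^ 2)) := by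
  have hL : ∀ i ∈ s, MemLp (fun ω => f (Z i ω)) 2 P := fun i hi => (hlaw i hi).memLp_comp hf
  have hc : (0 : ℝ) < s.card := by exact_mod_cast hs
  have hmean : ∫ ω, ∑ i ∈ s, f (Z i ω) ∂P = s.card * ∫ x, f x ∂ν := by
    rw [integral_finsetSum s fun i hi => (hL i hi).integrable one_le_two,
      Finset.sum_congr rfl fun i hi => (hlaw i hi).integral_comp' hf.aestronglyMeasurable]
    simp
  have hν : ∑ i ∈ s, ∫ x, f x ^ 2 ∂ν = s.card * ∫ x, f x ^ 2 ∂ν := by simp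
  refine le_trans (measure_mono fun ω hω => ?_) ((meas_ge_le_variance_div_sq
    (memLp_finsetSum s hL) (mul_pos hc hε)).trans (ENNReal.ofReal_le_ofReal ?_))
  · simp only [Set.mem_ofPred_eq] at hω ⊢
    rw [hmean]
    have : ∑ i ∈ s, f (Z i ω) - s.card * ∫ x, f x ∂ν =
        s.card * ((s.card : ℝ)⁻¹ * ∑ i ∈ s, f (Z i ω) - ∫ x, f x ∂ν) := by
      field_simp
    rw [this, abs_mul, abs_of_pos hc]
    gcongr
  · calc _ ≤ (∑ i ∈ s, ∫ x, f x ^ 2 ∂ν) / (s.card * ε) ^ 2 := by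
          gcongr
          exact variance_sum_comp_le (μ := fun _ => ν) hind hlaw fun _ _ => hf
      _ = _ := by
          rw [hν]; field_simp

/-- A weak law of large numbers for empirical means, uniform over the samples of a given law. -/
lemma exists_meas_empirical_sub_gt_le [IsProbabilityMeasure P] [IsProbabilityMeasure ν]
    (hf : Integrable f ν) {ε η : ℝ} (hε : 0 < ε) (hη : 0 < η) :
    ∃ n₀ : ℕ, ∀ (ι : Type) (Z : ι → Ω → S) (s : Finset ι), iIndepFun Z P →
      (∀ i ∈ s, HasLaw (Z i) ν P) → n₀ ≤ s.card →
      P {ω | ε < |(s.card : ℝ)⁻¹ * ∑ i ∈ s, f (Z i ω) - ∫ x, f x ∂ν|} ≤ ENNReal.ofReal η := by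
  -- Approximate `f` in L¹ by a simple function `g`, within `d`. The error `ε` is split in three:
  -- Chebyshev handles the mean of `g`, Markov the mean of `|f - g|`, and `d ≤ ε / 3` the difference
  -- of the integrals. The bound `ε * η / 6` gives Markov the probability `η / 2`.
  set d : ℝ := min (ε / 3) (ε * η / 6) with hd
  have hd0 : 0 < d := by positivity
  obtain ⟨g, hg, -⟩ := (memLp_one_iff_integrable.2 hf).exists_simpleFunc_eLpNorm_sub_lt (by simp)
    (ε := ENNReal.ofReal d) (by simpa using hd0)
  have hg2 : MemLp g 2 ν := (g.memLp_top ν).mono_exponent le_top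
  have hgi : Integrable g ν := hg2.integrable one_le_two
  have hfg : ∫ x, |f x - g x| ∂ν ≤ d := by
    have : eLpNorm (f - ⇑g) 1 ν = ENNReal.ofReal (∫ x, ‖(f - ⇑g) x‖ ∂ν) := by
      rw [eLpNorm_one_eq_lintegral_enorm, ofReal_integral_norm_eq_lintegral_enorm (hf.sub hgi)]
    rw [this] at hg
    exact ((ENNReal.ofReal_lt_ofReal_iff hd0).1 hg).le
  obtain ⟨n₁, hn₁⟩ := exists_nat_gt ((∫ x, g x ^ 2 ∂ν) / ((ε / 3) ^ 2 * (η / 2)))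
  refine ⟨n₁ + 1, fun ι Z s hind hlaw hs => ?_⟩
  have hs0 : 0 < s.card := by omega
  have hc : (0 : ℝ) < s.card := by exact_mod_cast hs0
  have h1 := meas_empirical_sub_ge_le hind hlaw hg2 hs0 (show 0 < ε / 3 by positivity)
  have hint : ∀ i ∈ s, Integrable (fun ω => |f (Z i ω) - g (Z i ω)|) P := fun i hi =>
    memLp_one_iff_integrable.1 ((hlaw i hi).memLp_comp
      (f := fun x => |f x - g x|) (memLp_one_iff_integrable.2 (hf.sub hgi).abs))
  have h2 : P {ω | ε / 3 ≤ (s.card : ℝ)⁻¹ * ∑ i ∈ s, |f (Z i ω) - g (Z i ω)|} ≤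
      ENNReal.ofReal (η / 2) := by
    have hm := mul_meas_ge_le_integral_of_nonneg (μ := P)
      (f := fun ω => (s.card : ℝ)⁻¹ * ∑ i ∈ s, |f (Z i ω) - g (Z i ω)|)
      (Eventually.of_forall fun ω => by positivity)
      ((integrable_finsetSum s hint).const_mul _) (ε / 3)
    have hmean : ∫ ω, (s.card : ℝ)⁻¹ * ∑ i ∈ s, |f (Z i ω) - g (Z i ω)| ∂P ≤ d := by
      rw [integral_const_mul, integral_finsetSum s hint,
        Finset.sum_congr rfl fun i hi => (hlaw i hi).integral_comp'
          (f := fun x => |f x - g x|) (hf.sub hgi).abs.aestronglyMeasurable]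
      simp only [Finset.sum_const, nsmul_eq_mul]
      rwa [inv_mul_cancel_left₀ hc.ne']
    rw [← ofReal_measureReal]
    refine ENNReal.ofReal_le_ofReal ?_
    have hd2 : d ≤ ε * η / 6 := min_le_right _ _
    have : ε / 3 * P.real {ω | ε / 3 ≤ (s.card : ℝ)⁻¹ * ∑ i ∈ s, |f (Z i ω) - g (Z i ω)|} ≤
        ε / 3 * (η / 2) := by linarith
    exact le_of_mul_le_mul_left this (by positivity)
  have h3 : (∫ x, g x ^ 2 ∂ν) / (s.card * (ε / 3) ^ 2) ≤ η / 2 := by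
    rw [div_lt_iff₀ (by positivity)] at hn₁
    rw [div_le_iff₀ (by positivity)]
    have : (n₁ : ℝ) ≤ s.card := by exact_mod_cast (by omega : n₁ ≤ s.card)
    calc _ ≤ n₁ * ((ε / 3) ^ 2 * (η / 2)) := hn₁.le
      _ ≤ s.card * ((ε / 3) ^ 2 * (η / 2)) := by gcongr
      _ = _ := by ring
  calc _ ≤ P ({ω | ε / 3 ≤ |(s.card : ℝ)⁻¹ * ∑ i ∈ s, g (Z i ω) - ∫ x, g x ∂ν|} ∪
        {ω | ε / 3 ≤ (s.card : ℝ)⁻¹ * ∑ i ∈ s, |f (Z i ω) - g (Z i ω)|}) := by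
        refine measure_mono fun ω hω => ?_
        simp only [Set.mem_ofPred_eq, Set.mem_union] at hω ⊢
        by_contra! hcon
        have e1 : |(s.card : ℝ)⁻¹ * ∑ i ∈ s, f (Z i ω) - (s.card : ℝ)⁻¹ * ∑ i ∈ s, g (Z i ω)| ≤
            (s.card : ℝ)⁻¹ * ∑ i ∈ s, |f (Z i ω) - g (Z i ω)| := by
          rw [← mul_sub, ← Finset.sum_sub_distrib, abs_mul, abs_of_pos (inv_pos.2 hc)]
          gcongr
          exact Finset.abs_sum_le_sum_abs _ _
        have e2 : |∫ x, f x ∂ν - ∫ x, g x ∂ν| ≤ ε / 3 := by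
          rw [← integral_sub hf hgi]
          exact (abs_integral_le_integral_abs.trans hfg).trans (min_le_left _ _)
        have e3 := abs_le.1 (e1.trans hcon.2.le)
        have e4 := abs_le.1 e2
        have e5 := abs_lt.1 hcon.1
        refine absurd hω (not_lt.2 (abs_le.2 ⟨?_, ?_⟩)) <;> linarith [e3.1, e3.2, e4.1, e4.2, e5.1, e5.2]
    _ ≤ ENNReal.ofReal (η / 2) + ENNReal.ofReal (η / 2) :=
        (measure_union_le _ _).trans (add_le_add (h1.trans (ENNReal.ofReal_le_ofReal h3)) h2)
    _ = ENNReal.ofReal η := by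
        rw [← ENNReal.ofReal_add (by positivity) (by positivity)]; congr 1; ring

end Sums

/-! ### Workers -/

section Workers

variable {p N K : ℕ}

/-- The mean of `f` over the observations of the `k`-th worker. -/
noncomputable def workerMean (w : Fin N → Fin K) (z : Fin N → Obs p) (k : Fin K) (f : Obs p → ℝ) : ℝ :=
  (workerSize w k : ℝ)⁻¹ * ∑ i ∈ workerSet w k, f (z i)

variable (w : Fin N → Fin K) (z : Fin N → Obs p)

lemma mem_workerSet {k : Fin K} {i : Fin N} : i ∈ workerSet w k ↔ w i = k := by
  simp [workerSet]

lemma sum_workerSet (g : Fin N → ℝ) : ∑ k, ∑ i ∈ workerSet w k, g i = ∑ i, g i := by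
  simpa [workerSet] using Finset.sum_fiberwise (Finset.univ : Finset (Fin N)) w g

lemma sum_workerWeight (hN : 0 < N) : ∑ k, workerWeight w k = 1 := by
  have h := sum_workerSet w (fun _ => (1 : ℝ))
  simp only [Finset.sum_const, nsmul_eq_mul, mul_one, Finset.card_univ, Fintype.card_fin] at h
  have hN' : (N : ℝ) ≠ 0 := by positivity
  simp only [workerWeight, workerSize, ← Finset.sum_div]
  rw [h, div_self hN']

lemma workerWeight_nonneg (k : Fin K) : 0 ≤ workerWeight w k := by
  unfold workerWeight; positivity

/-- The weight n_k / N cancels the local normalization, so averaging local scores recovers the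
accuracy of the whole sample. -/
lemma sum_workerWeight_mul_workerMean (hpos : ∀ k, 0 < workerSize w k) (f : Obs p → ℝ) :
    ∑ k, workerWeight w k * workerMean w z k f = (N : ℝ)⁻¹ * ∑ i, f (z i) := by
  rw [← sum_workerSet w, Finset.mul_sum]
  refine Finset.sum_congr rfl fun k _ => ?_
  have := hpos k
  unfold workerWeight workerMean
  field_simp

end Workers

section Sampling

variable {p : ℕ} {Ω : Type*} [MeasurableSpace Ω] {P : Measure Ω}
  {K : ℕ → ℕ} {w : (N : ℕ) → Fin N → Fin (K N)} {Z : (N : ℕ) → Fin N → Ω → Obs p}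
  {ν : ℕ → Measure (Obs p)} {f : Obs p → ℝ} {D : ℝ}

lemma pos_of_fin_map {N K : ℕ} (w : Fin N → Fin K) (hN : 0 < N) : 0 < K :=
  (w ⟨0, hN⟩).pos

lemma CondWorkers.exists_le (hW : CondWorkers K w) :
    ∃ c > 0, ∀ N, 0 < N → ∀ k, 0 < workerSize (w N) k ∧
      c * ((N : ℝ) / K N) ≤ workerSize (w N) k := by
  obtain ⟨⟨c, _, hc, h⟩, _⟩ := hW
  refine ⟨c, hc, fun N hN k => ⟨?_, (h N k).1⟩⟩
  have hK := pos_of_fin_map (w N) hN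
  have : (0 : ℝ) < workerSize (w N) k := lt_of_lt_of_le (by positivity) (h N k).1
  exact_mod_cast this

/-- K/√N is the reciprocal of n/√N. -/
lemma CondWorkers.tendsto_div_sqrt (hW : CondWorkers K w) :
    Tendsto (fun N : ℕ => (K N : ℝ) / Real.sqrt N) atTop (𝓝 0) := by
  refine (tendsto_inv_atTop_zero.comp hW.2).congr' ?_
  filter_upwards [eventually_gt_atTop 0] with N hN
  have h1 : (0 : ℝ) < N := by exact_mod_cast hN
  have h2 : (0 : ℝ) < K N := by exact_mod_cast pos_of_fin_map (w N) hN
  have h3 : Real.sqrt N * Real.sqrt N = N := Real.mul_self_sqrt h1.le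
  have h4 : 0 < Real.sqrt N := Real.sqrt_pos.2 h1
  simp only [Function.comp]
  rw [div_div, inv_div, div_eq_div_iff h1.ne' h4.ne', mul_assoc, h3]

lemma CondSampling.hasLaw_worker (hS : CondSampling P K w Z ν) (N : ℕ) (k : Fin (K N)) :
    ∀ i ∈ workerSet (w N) k, HasLaw (Z N i) (ν k) P := fun i hi => by
  have := (hS N).2 i
  rwa [(mem_workerSet (w N)).1 hi] at this

/-- The union bound over the workers. -/
lemma measure_not_forall_worker_le {N : ℕ} {A : Fin (K N) → Ω → Prop} {e : ℝ}
    (h : ∀ k, P {ω | ¬ A k ω} ≤ ENNReal.ofReal e) :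
    P {ω | ¬ ∀ k, A k ω} ≤ ENNReal.ofReal (K N * e) := by
  calc P {ω | ¬ ∀ k, A k ω} ≤ P (⋃ k, {ω | ¬ A k ω}) :=
        measure_mono fun ω hω => by simpa using hω
    _ ≤ ∑ k, P {ω | ¬ A k ω} := measure_iUnion_fintype_le _ _
    _ ≤ ∑ _k : Fin (K N), ENNReal.ofReal e := Finset.sum_le_sum fun k _ => h k
    _ = ENNReal.ofReal (K N * e) := by
        rw [Finset.sum_const, Finset.card_univ, Fintype.card_fin, nsmul_eq_mul,
          ENNReal.ofReal_mul (by positivity), ENNReal.ofReal_natCast]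

variable [IsProbabilityMeasure P]

/-- The law of large numbers, uniformly over a growing number of workers. -/
lemma highProb_workerMean_of_memLp_two (hW : CondWorkers K w) (hS : CondSampling P K w Z ν)
    (hf : ∀ k, MemLp f 2 (ν k)) (hD : ∀ k, ∫ x, f x ^ 2 ∂ν k ≤ D) {ε : ℝ} (hε : 0 < ε) :
    HighProb P fun N ω => ∀ k : Fin (K N),
      |workerMean (w N) (fun i => Z N i ω) k f - ∫ x, f x ∂ν k| ≤ ε := by
  obtain ⟨c, hc, hsize⟩ := hW.exists_le
  have hD0 : 0 ≤ D := (integral_nonneg fun x => sq_nonneg (f x)).trans (hD 0)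
  -- K Chebyshev bounds D / (c n ε²) with n = N/K add up to a constant times K²/N.
  have hu : Tendsto (fun N : ℕ => D / (c * ε ^ 2) * ((K N : ℝ) / Real.sqrt N) ^ 2) atTop (𝓝 0) := by
    simpa using (hW.tendsto_div_sqrt.pow 2).const_mul (D / (c * ε ^ 2))
  refine highProb_of_le_ofReal hu ?_
  filter_upwards [eventually_gt_atTop 0] with N hN
  have h1 : (0 : ℝ) < N := by exact_mod_cast hN
  have h2 : (0 : ℝ) < K N := by exact_mod_cast pos_of_fin_map (w N) hN
  have key := measure_not_forall_worker_le (P := P) (K := K) (N := N)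
    (A := fun k ω => |workerMean (w N) (fun i => Z N i ω) k f - ∫ x, f x ∂ν k| ≤ ε)
    (e := D / (c * (N / K N) * ε ^ 2)) fun k => by
      have hk := hsize N hN k
      refine le_trans (measure_mono fun ω hω => ?_) ((meas_empirical_sub_ge_le (hS N).1
        (hS.hasLaw_worker N k) (hf k) hk.1 hε).trans (ENNReal.ofReal_le_ofReal ?_))
      · exact (not_le.1 hω).le
      · have := hk.2
        unfold workerSize at this
        gcongr
        exact hD k
  refine key.trans_eq ?_
  rw [div_pow, Real.sq_sqrt h1.le]
  congr 1
  field_simp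

/-- The law of large numbers over a bounded number of workers. -/
lemma highProb_workerMean_of_bounded [∀ k, IsProbabilityMeasure (ν k)] {K₀ : ℕ}
    (hW : CondWorkers K w) (hS : CondSampling P K w Z ν)
    (hK : ∀ N, K N ≤ K₀) (hf : ∀ k, Integrable f (ν k)) {ε : ℝ} (hε : 0 < ε) :
    HighProb P fun N ω => ∀ k : Fin (K N),
      |workerMean (w N) (fun i => Z N i ω) k f - ∫ x, f x ∂ν k| ≤ ε := by
  obtain ⟨c, hc, hsize⟩ := hW.exists_le
  have hK0 : (0 : ℝ) < K₀ := by
    exact_mod_cast (pos_of_fin_map (w 1) one_pos).trans_le (hK 1)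
  refine ENNReal.tendsto_nhds_zero.2 fun e he => ?_
  obtain ⟨η, hη, hηe⟩ : ∃ η : ℝ, 0 < η ∧ ENNReal.ofReal η ≤ e := by
    rcases eq_or_ne e ∞ with rfl | h
    · exact ⟨1, one_pos, le_top⟩
    · exact ⟨e.toReal, ENNReal.toReal_pos he.ne' h, ENNReal.ofReal_toReal_le⟩
  -- Only finitely many laws occur, so one sample size serves them all; each worker gets the share
  -- `η / K₀` of the error probability.
  choose n₀ hn₀ using fun k : ℕ => exists_meas_empirical_sub_gt_le (P := P) (hf k) hε
    (show 0 < η / K₀ by positivity)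
  obtain ⟨n₁, hn₁⟩ : ∃ n₁, ∀ k < K₀, n₀ k ≤ n₁ :=
    ⟨∑ k ∈ Finset.range K₀, n₀ k, fun k hk =>
      Finset.single_le_sum (f := n₀) (fun _ _ => Nat.zero_le _) (Finset.mem_range.2 hk)⟩
  have hlarge : ∀ᶠ N : ℕ in atTop, (n₁ : ℝ) ≤ c * (N / K₀) :=
    ((tendsto_natCast_atTop_atTop.atTop_div_const hK0).const_mul_atTop hc).eventually_ge_atTop _
  filter_upwards [hlarge, eventually_gt_atTop 0] with N hN hN0
  have h2 : (0 : ℝ) < K N := by exact_mod_cast pos_of_fin_map (w N) hN0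
  have hKN : (K N : ℝ) ≤ K₀ := by exact_mod_cast hK N
  refine (measure_not_forall_worker_le (e := η / K₀) fun k => ?_).trans
    ((ENNReal.ofReal_le_ofReal ?_).trans hηe)
  · refine le_trans (measure_mono fun ω hω => ?_)
      (hn₀ k (Fin N) (Z N) (workerSet (w N) k) (hS N).1 (hS.hasLaw_worker N k) ?_)
    · exact not_le.1 hω
    · refine (hn₁ k (k.2.trans_le (hK N))).trans ?_
      have : (n₁ : ℝ) ≤ workerSize (w N) k := by
        refine hN.trans (le_trans ?_ (hsize N hN0 k).2)
        gcongr
      exact_mod_cast this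
  · calc (K N : ℝ) * (η / K₀) ≤ K₀ * (η / K₀) := by gcongr
      _ = η := by field_simp

/-- The order `√(log N / N)`. -/
noncomputable def critRate (N : ℕ) : ℝ := Real.sqrt (Real.log N / N)

lemma critRate_pos {N : ℕ} (hN : 1 < N) : 0 < critRate N := by
  have : 0 < Real.log N := Real.log_pos (by exact_mod_cast hN)
  unfold critRate; positivity

lemma critRate_sq (N : ℕ) : critRate N ^ 2 = Real.log N / N :=
  Real.sq_sqrt (by have := Real.log_natCast_nonneg N; positivity)

lemma tendsto_log_natCast : Tendsto (fun N : ℕ => Real.log N) atTop atTop :=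
  Real.tendsto_log_atTop.comp tendsto_natCast_atTop_atTop

/-- The mean of a centred function over the whole sample is of a smaller order than
`√(log N / N)`. -/
lemma highProb_mean_le (hS : CondSampling P K w Z ν) (hf : ∀ k, MemLp f 2 (ν k))
    (h0 : ∀ k, ∫ x, f x ∂ν k = 0) (hD : ∀ N, ∀ k : Fin (K N), ∫ x, f x ^ 2 ∂ν k ≤ D)
    {ε : ℝ} (hε : 0 < ε) :
    HighProb P fun N ω => |(N : ℝ)⁻¹ * ∑ i, f (Z N i ω)| ≤ ε * critRate N := by
  -- The sum has second moment at most N D, to be compared with (N ε r)² = ε² N log N: the logarithm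
  -- alone makes the quotient vanish.
  have hu : Tendsto (fun N : ℕ => D / ε ^ 2 / Real.log N) atTop (𝓝 0) :=
    tendsto_log_natCast.const_div_atTop _
  refine highProb_of_le_ofReal hu ?_
  filter_upwards [eventually_gt_atTop 1] with N hN
  have h1 : (0 : ℝ) < N := by positivity
  have hl : 0 < Real.log N := Real.log_pos (by exact_mod_cast hN)
  have hr := critRate_pos hN
  have hlaw : ∀ i ∈ (Finset.univ : Finset (Fin N)), HasLaw (Z N i) (ν (w N i)) P :=
    fun i _ => (hS N).2 i
  have hI := integral_sq_sum_comp_le (hS N).1 hlaw (fun i _ => hf _) (fun i _ => h0 _)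
  have hI2 : ∫ ω, (∑ i, f (Z N i ω)) ^ 2 ∂P ≤ N * D :=
    hI.trans ((Finset.sum_le_sum fun i _ => hD N (w N i)).trans_eq (by simp))
  have hm := mul_meas_ge_le_integral_of_nonneg (μ := P) (Eventually.of_forall fun ω =>
    sq_nonneg (∑ i, f (Z N i ω))) (integrable_sq_sum_comp hlaw fun i _ => hf _)
    ((N * (ε * critRate N)) ^ 2)
  refine (measure_mono (t := {ω | (N * (ε * critRate N)) ^ 2 ≤ (∑ i, f (Z N i ω)) ^ 2})
    fun ω hω => ?_).trans ?_
  · have h : ε * critRate N < |(N : ℝ)⁻¹ * ∑ i, f (Z N i ω)| := not_le.1 hω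
    rw [abs_mul, abs_of_pos (inv_pos.2 h1), ← div_eq_inv_mul, lt_div_iff₀ h1, mul_comm] at h
    rw [Set.mem_ofPred_eq, ← sq_abs (∑ i, f (Z N i ω))]
    exact pow_le_pow_left₀ (by positivity) h.le 2
  · rw [← ofReal_measureReal]
    refine ENNReal.ofReal_le_ofReal ?_
    have h3 := hm.trans hI2
    rw [mul_pow, mul_pow, critRate_sq] at h3
    rw [div_div, le_div_iff₀ (by positivity)]
    have h4 : (N : ℝ) * (P.real {ω | (N * (ε * critRate N)) ^ 2 ≤ (∑ i, f (Z N i ω)) ^ 2} *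
        (ε ^ 2 * Real.log N)) ≤ N * D := by
      refine le_trans (le_of_eq ?_) h3
      rw [mul_pow, mul_pow, critRate_sq]
      field_simp
    exact le_of_mul_le_mul_left h4 h1

/-- The weighted mean of the squares of the local means of a centred function is of a smaller
order than `√(log N / N)`. -/
lemma highProb_sum_workerMean_sq_le (hW : CondWorkers K w) (hS : CondSampling P K w Z ν)
    (hf : ∀ k, MemLp f 2 (ν k))
    (h0 : ∀ k, ∫ x, f x ∂ν k = 0) (hD : ∀ N, ∀ k : Fin (K N), ∫ x, f x ^ 2 ∂ν k ≤ D)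
    {ε : ℝ} (hε : 0 < ε) :
    HighProb P fun N ω => ∑ k, workerWeight (w N) k *
      workerMean (w N) (fun i => Z N i ω) k f ^ 2 ≤ ε * critRate N := by
  obtain ⟨c, hc, hsize⟩ := hW.exists_le
  -- Each summand has expectation at most α_k D / n_k = D / N, so the sum has at most K D / N; this
  -- is Markov's bound after division by ε r.
  have hu : Tendsto (fun N : ℕ => D / ε * ((K N : ℝ) / Real.sqrt N) * (Real.sqrt (Real.log N))⁻¹)
      atTop (𝓝 0) := by
    have := (hW.tendsto_div_sqrt.const_mul (D / ε)).mul
      (tendsto_inv_atTop_zero.comp (Real.tendsto_sqrt_atTop.comp tendsto_log_natCast))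
    simpa using this
  refine highProb_of_le_ofReal hu ?_
  filter_upwards [eventually_gt_atTop 1] with N hN
  have h1 : (0 : ℝ) < N := by positivity
  have hl : 0 < Real.log N := Real.log_pos (by exact_mod_cast hN)
  have hr := critRate_pos hN
  have hint : ∀ k : Fin (K N), Integrable (fun ω =>
      workerWeight (w N) k * workerMean (w N) (fun i => Z N i ω) k f ^ 2) P := fun k => by
    simp only [workerMean, mul_pow]
    exact ((integrable_sq_sum_comp (hS.hasLaw_worker N k) fun i _ => hf k).const_mul _).const_mul _
  have hI : ∫ ω, ∑ k, workerWeight (w N) k *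
      workerMean (w N) (fun i => Z N i ω) k f ^ 2 ∂P ≤ K N * (D / N) := by
    rw [integral_finsetSum _ fun k _ => hint k]
    calc _ ≤ ∑ _k : Fin (K N), D / N := Finset.sum_le_sum fun k _ => ?_
      _ = _ := by simp
    have hk : (0 : ℝ) < workerSize (w N) k := by exact_mod_cast (hsize N (by omega) k).1
    simp only [workerMean, mul_pow]
    rw [integral_const_mul, integral_const_mul]
    have h2 := integral_sq_sum_comp_le (hS N).1 (hS.hasLaw_worker N k) (fun i _ => hf k)
      (fun i _ => h0 k)
    have h3 : ∫ ω, (∑ i ∈ workerSet (w N) k, f (Z N i ω)) ^ 2 ∂P ≤ workerSize (w N) k * D := by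
      refine h2.trans ?_
      rw [Finset.sum_const, nsmul_eq_mul]
      exact mul_le_mul_of_nonneg_left (hD N k) hk.le
    calc _ ≤ (workerSize (w N) k : ℝ) / N *
          ((workerSize (w N) k : ℝ)⁻¹ ^ 2 * (workerSize (w N) k * D)) := by
          unfold workerWeight; gcongr
      _ = D / N := by field_simp
  have hm := mul_meas_ge_le_integral_of_nonneg (μ := P) (f := fun ω => ∑ k, workerWeight (w N) k *
    workerMean (w N) (fun i => Z N i ω) k f ^ 2) (Eventually.of_forall fun ω =>
    Finset.sum_nonneg fun k _ => mul_nonneg (workerWeight_nonneg (w N) k)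
      (sq_nonneg (workerMean (w N) (fun i => Z N i ω) k f)))
    (integrable_finsetSum _ fun k _ => hint k) (ε * critRate N)
  refine (measure_mono (t := {ω | ε * critRate N ≤ ∑ k, workerWeight (w N) k *
      workerMean (w N) (fun i => Z N i ω) k f ^ 2}) fun ω hω => (not_le.1 hω).le).trans ?_
  rw [← ofReal_measureReal]
  refine ENNReal.ofReal_le_ofReal ?_
  have h3 := hm.trans hI
  have hrate : critRate N = Real.sqrt (Real.log N) / Real.sqrt N := Real.sqrt_div hl.le _
  have hs := Real.sqrt_pos.2 h1
  have hs2 := Real.sqrt_pos.2 hl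
  have hss := Real.mul_self_sqrt h1.le
  rw [mul_comm, ← le_div_iff₀ (by positivity)] at h3
  refine h3.trans_eq ?_
  rw [hrate]
  field_simp
  rw [pow_two, hss]

end Sampling

/-! ### Deterministic expansion of the local estimators -/

section WorkerMean

variable {p N K : ℕ} (w : Fin N → Fin K) (z : Fin N → Obs p) (k : Fin K)

lemma workerMean_add (f g : Obs p → ℝ) :
    workerMean w z k (fun x => f x + g x) = workerMean w z k f + workerMean w z k g := by
  simp [workerMean, Finset.sum_add_distrib, mul_add]

lemma workerMean_sub (f g : Obs p → ℝ) :
    workerMean w z k (fun x => f x - g x) = workerMean w z k f - workerMean w z k g := by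
  simp [workerMean, Finset.sum_sub_distrib, mul_sub]

lemma workerMean_mul_const (f : Obs p → ℝ) (a : ℝ) :
    workerMean w z k (fun x => f x * a) = workerMean w z k f * a := by
  simp [workerMean, ← Finset.sum_mul, mul_assoc]

lemma workerMean_sum {ι : Type*} (s : Finset ι) (f : ι → Obs p → ℝ) :
    workerMean w z k (fun x => ∑ i ∈ s, f i x) = ∑ i ∈ s, workerMean w z k (f i) := by
  simp only [workerMean]
  rw [Finset.sum_comm, Finset.mul_sum]

lemma abs_workerMean_le {f g : Obs p → ℝ} (h : ∀ i, |f (z i)| ≤ g (z i)) :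
    |workerMean w z k f| ≤ workerMean w z k g := by
  unfold workerMean
  rw [abs_mul, abs_of_nonneg (by positivity : (0 : ℝ) ≤ (workerSize w k : ℝ)⁻¹)]
  gcongr
  exact (Finset.abs_sum_le_sum_abs _ _).trans (Finset.sum_le_sum fun i _ => h i)

end WorkerMean

/-- The loss at the observation `z` has third derivatives on the ball of radius `δ`, dominated by
`M · · · z`. -/
def SmoothObs {p : ℕ} (loss : Vec p → Obs p → ℝ) (θ₀ : Vec p) (δ : ℝ)
    (M : Fin p → Fin p → Fin p → Obs p → ℝ) (z : Obs p) : Prop :=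
  ∀ θ ∈ Metric.ball θ₀ δ,
    DifferentiableAt ℝ (fun t => loss t z) θ ∧
    DifferentiableAt ℝ (fderiv ℝ (fun t => loss t z)) θ ∧
    DifferentiableAt ℝ (fderiv ℝ (fderiv ℝ (fun t => loss t z))) θ ∧
    ∀ i j l, |d3Loss loss θ z i j l| ≤ M i j l z

/-- The sum of the dominating functions. -/
def totalBound {p : ℕ} (M : Fin p → Fin p → Fin p → Obs p → ℝ) (z : Obs p) : ℝ :=
  ∑ i, ∑ j, ∑ l, M i j l z

section SmoothObs

variable {p : ℕ} {loss : Vec p → Obs p → ℝ} {θ₀ : Vec p} {δ : ℝ}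
  {M : Fin p → Fin p → Fin p → Obs p → ℝ} {z : Obs p} {θ : Vec p}

set_option maxSynthPendingDepth 3 in
lemma SmoothObs.norm_le (h : SmoothObs loss θ₀ δ M z) : ∀ θ ∈ Metric.ball θ₀ δ,
    ‖fderiv ℝ (fderiv ℝ (fderiv ℝ (fun t => loss t z))) θ‖ ≤ totalBound M z := fun θ hθ =>
  norm_trilinear_le _ (fun i j l => M i j l z) (h θ hθ).2.2.2

lemma SmoothObs.abs_snd_sub_le (h : SmoothObs loss θ₀ δ M z) (hθ : θ ∈ Metric.ball θ₀ δ)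
    (u v : Vec p) :
    |fderiv ℝ (fderiv ℝ (fun t => loss t z)) θ u v -
      fderiv ℝ (fderiv ℝ (fun t => loss t z)) θ₀ u v| ≤
      totalBound M z * (‖θ - θ₀‖ * ‖u‖ * ‖v‖) := by
  have h0 := Metric.mem_ball_self (x := θ₀) (dist_nonneg.trans_lt hθ)
  have h1 := norm_fderiv_fderiv_sub_le (fun θ hθ => (h θ hθ).2.2.1) h.norm_le h0 hθ
  have h2 := ContinuousLinearMap.le_opNorm₂ (fderiv ℝ (fderiv ℝ (fun t => loss t z)) θ -
      fderiv ℝ (fderiv ℝ (fun t => loss t z)) θ₀) u v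
  calc _ ≤ _ := h2
    _ ≤ totalBound M z * ‖θ - θ₀‖ * ‖u‖ * ‖v‖ := by gcongr
    _ = _ := by ring

lemma SmoothObs.abs_taylor_le (h : SmoothObs loss θ₀ δ M z) (hθ : θ ∈ Metric.ball θ₀ δ)
    (v : Vec p) :
    |fderiv ℝ (fun t => loss t z) θ₀ v - fderiv ℝ (fun t => loss t z) θ v +
      fderiv ℝ (fderiv ℝ (fun t => loss t z)) θ (θ - θ₀) v| ≤
      totalBound M z * (‖θ - θ₀‖ ^ 2 * ‖v‖) := by
  have h1 := norm_fderiv_taylor_le (fun θ hθ => (h θ hθ).2.1) (fun θ hθ => (h θ hθ).2.2.1)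
    h.norm_le hθ
  have h2 := ContinuousLinearMap.le_opNorm (fderiv ℝ (fun t => loss t z) θ₀ -
    fderiv ℝ (fun t => loss t z) θ - fderiv ℝ (fderiv ℝ (fun t => loss t z)) θ (θ₀ - θ)) v
  have e : (fderiv ℝ (fun t => loss t z) θ₀ - fderiv ℝ (fun t => loss t z) θ -
      fderiv ℝ (fderiv ℝ (fun t => loss t z)) θ (θ₀ - θ)) v =
      fderiv ℝ (fun t => loss t z) θ₀ v - fderiv ℝ (fun t => loss t z) θ v +
      fderiv ℝ (fderiv ℝ (fun t => loss t z)) θ (θ - θ₀) v := by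
    rw [← neg_sub θ θ₀, map_neg]
    simp
    ring
  rw [e, Real.norm_eq_abs] at h2
  calc _ ≤ _ := h2
    _ ≤ totalBound M z * ‖θ - θ₀‖ ^ 2 * ‖v‖ := by gcongr
    _ = _ := by ring

end SmoothObs

section LocalEstimator

variable {p N K : ℕ} {loss : Vec p → Obs p → ℝ} {w : Fin N → Fin K} {z : Fin N → Obs p}
  {θ₀ : Vec p} {δ : ℝ} {M : Fin p → Fin p → Fin p → Obs p → ℝ} {k : Fin K} {θ : Vec p}

lemma bil_localHess (θ u v : Vec p) : bil (localHess loss w z k θ) u v =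
    workerMean w z k fun x => fderiv ℝ (fderiv ℝ (fun t => loss t x)) θ u v := by
  simp only [localHess, bil_smul_matrix, bil_sum_matrix, bil_hessLoss, workerMean]

lemma localHess_apply (i j : Fin p) : localHess loss w z k θ i j =
    workerMean w z k fun x => d2Loss loss θ x i j := by
  simp [localHess, hessLoss, workerMean, Matrix.sum_apply]

lemma bil_localHess_symm (h : ∀ i, SmoothObs loss θ₀ δ M (z i)) (hθ : θ ∈ Metric.ball θ₀ δ)
    (u v : Vec p) : bil (localHess loss w z k θ) u v = bil (localHess loss w z k θ) v u := by
  simp only [bil_localHess, workerMean]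
  congr 1
  refine Finset.sum_congr rfl fun i _ => ?_
  exact fderiv_fderiv_symm (fun θ hθ => (h i θ hθ).1) (fun θ hθ => (h i θ hθ).2.1) hθ u v

lemma abs_bil_localHess_sub_le (h : ∀ i, SmoothObs loss θ₀ δ M (z i))
    (hθ : θ ∈ Metric.ball θ₀ δ) (u v : Vec p) :
    |bil (localHess loss w z k θ) u v - bil (localHess loss w z k θ₀) u v| ≤
      workerMean w z k (totalBound M) * (‖θ - θ₀‖ * ‖u‖ * ‖v‖) := by
  rw [bil_localHess, bil_localHess, ← workerMean_sub, ← workerMean_mul_const]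
  exact abs_workerMean_le w z k fun i => (h i).abs_snd_sub_le hθ u v

/-- As the ball lies in `Θ`, a minimizer in it is interior, and the first-order condition holds
although `Θ` constrains the minimization. -/
lemma workerMean_fderiv_eq_zero {Θ : Set (Vec p)} (h : ∀ i, SmoothObs loss θ₀ δ M (z i))
    (hθ : θ ∈ Metric.ball θ₀ δ) (hΘ : Metric.ball θ₀ δ ⊆ Θ)
    (hmin : IsMinOn (localLoss loss w z k) Θ θ) (v : Vec p) :
    workerMean w z k (fun x => fderiv ℝ (fun t => loss t x) θ v) = 0 := by
  have hloc : IsLocalMin (localLoss loss w z k) θ :=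
    hmin.isLocalMin (Filter.mem_of_superset (Metric.isOpen_ball.mem_nhds hθ) hΘ)
  have hd : HasFDerivAt (localLoss loss w z k) ((workerSize w k : ℝ)⁻¹ •
      ∑ i ∈ workerSet w k, fderiv ℝ (fun t => loss t (z i)) θ) θ :=
    (HasFDerivAt.fun_sum fun i _ => (h i θ hθ).1.hasFDerivAt).const_mul _
  have := DFunLike.congr_fun (hloc.hasFDerivAt_eq_zero hd) v
  simpa [workerMean] using this

/-- The basic linearization: averaging the Taylor bound at the estimate removes the gradient there
and leaves the local Hessian, the score at `θ₀` and a quadratic remainder. -/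
lemma abs_bil_localHess_add_score_le {Θ : Set (Vec p)} (h : ∀ i, SmoothObs loss θ₀ δ M (z i))
    (hθ : θ ∈ Metric.ball θ₀ δ) (hΘ : Metric.ball θ₀ δ ⊆ Θ)
    (hmin : IsMinOn (localLoss loss w z k) Θ θ) (v : Vec p) :
    |bil (localHess loss w z k θ) (θ - θ₀) v +
      ∑ i, v i * workerMean w z k (fun x => dLoss loss θ₀ x i)| ≤
      workerMean w z k (totalBound M) * (‖θ - θ₀‖ ^ 2 * ‖v‖) := by
  have e : bil (localHess loss w z k θ) (θ - θ₀) v +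
      ∑ i, v i * workerMean w z k (fun x => dLoss loss θ₀ x i) =
      workerMean w z k fun x => fderiv ℝ (fun t => loss t x) θ₀ v -
        fderiv ℝ (fun t => loss t x) θ v +
        fderiv ℝ (fderiv ℝ (fun t => loss t x)) θ (θ - θ₀) v := by
    rw [workerMean_add, workerMean_sub, workerMean_fderiv_eq_zero h hθ hΘ hmin, bil_localHess,
      sub_zero, add_comm]
    congr 1
    simp_rw [fderiv_eq_sum_dLoss, mul_comm (v _)]
    rw [workerMean_sum]
    simp_rw [workerMean_mul_const]
  rw [e, ← workerMean_mul_const]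
  exact abs_workerMean_le w z k fun i => (h i).abs_taylor_le hθ v

lemma norm_le_of_quadratic_bound {E : Type*} [SeminormedAddCommGroup E] {x : E} {c a : ℝ}
    (h : c * ‖x‖ ^ 2 ≤ a * ‖x‖) (ha : 0 ≤ a) : c * ‖x‖ ≤ a := by
  rcases (norm_nonneg x).eq_or_lt with h0 | h0
  · rw [← h0]; simpa using ha
  · refine le_of_mul_le_mul_right ?_ h0
    calc c * ‖x‖ * ‖x‖ = c * ‖x‖ ^ 2 := by ring
      _ ≤ _ := h

lemma abs_sum_coord_mul_le (v : Vec p) (g : Fin p → ℝ) :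
    |∑ i, v i * g i| ≤ (∑ i, |g i|) * ‖v‖ := by
  rw [Finset.sum_mul]
  refine (Finset.abs_sum_le_sum_abs _ _).trans (Finset.sum_le_sum fun i _ => ?_)
  rw [abs_mul, mul_comm]
  gcongr
  exact norm_coord_le v i

end LocalEstimator

/-! ### The weighted least squares estimator -/

section Wlse

variable {p N K : ℕ} {loss : Vec p → Obs p → ℝ} {w : Fin N → Fin K} {z : Fin N → Obs p}
  {θhat : Fin K → Vec p} {θ₀ : Vec p} {b c C : ℝ}

lemma isUnit_of_bil_ge {A : Matrix (Fin p) (Fin p) ℝ} (hc : 0 < c)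
    (h : ∀ v : Vec p, c * ‖v‖ ^ 2 ≤ bil A v v) : IsUnit A := by
  rw [← Matrix.mulVec_injective_iff_isUnit]
  intro u v huv
  have h1 := h (WithLp.toLp 2 (u - v))
  have h2 : bil A (WithLp.toLp 2 (u - v)) (WithLp.toLp 2 (u - v)) = 0 := by
    have : A *ᵥ (u - v) = 0 := by rw [Matrix.mulVec_sub]; exact sub_eq_zero.2 huv
    simp [bil, this]
  rw [h2] at h1
  have h3 : ‖WithLp.toLp 2 (u - v)‖ ^ 2 ≤ 0 := by
    by_contra! hcon
    have := mul_pos hc hcon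
    linarith
  have h4 : WithLp.toLp 2 (u - v) = (0 : Vec p) := by
    rw [← norm_eq_zero]; exact pow_eq_zero_iff two_ne_zero |>.1 (le_antisymm h3 (by positivity))
  have h5 : u - v = 0 := congrArg WithLp.ofLp h4
  exact sub_eq_zero.1 h5

lemma bil_precision (u v : Vec p) : bil (precision loss w z θhat) u v =
    ∑ k, workerWeight w k * bil (localHess loss w z k (θhat k)) u v := by
  simp only [precision, bil_sum_matrix, bil_smul_matrix]

lemma bil_precision_ge (hN : 0 < N)
    (hH : ∀ k, ∀ v : Vec p, c * ‖v‖ ^ 2 ≤ bil (localHess loss w z k (θhat k)) v v) (v : Vec p) :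
    c * ‖v‖ ^ 2 ≤ bil (precision loss w z θhat) v v := by
  rw [bil_precision]
  calc c * ‖v‖ ^ 2 = ∑ k, workerWeight w k * (c * ‖v‖ ^ 2) := by
        rw [← Finset.sum_mul, sum_workerWeight w hN, one_mul]
    _ ≤ _ := Finset.sum_le_sum fun k _ =>
        mul_le_mul_of_nonneg_left (hH k v) (workerWeight_nonneg w k)

lemma abs_bil_precision_le (hN : 0 < N) (hH : ∀ k, ∀ u v : Vec p,
    |bil (localHess loss w z k (θhat k)) u v| ≤ C * ‖u‖ * ‖v‖) (u v : Vec p) :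
    |bil (precision loss w z θhat) u v| ≤ C * ‖u‖ * ‖v‖ := by
  rw [bil_precision]
  calc _ ≤ ∑ k, workerWeight w k * (C * ‖u‖ * ‖v‖) := by
        refine (Finset.abs_sum_le_sum_abs _ _).trans (Finset.sum_le_sum fun k _ => ?_)
        rw [abs_mul, abs_of_nonneg (workerWeight_nonneg w k)]
        exact mul_le_mul_of_nonneg_left (hH k u v) (workerWeight_nonneg w k)
    _ = _ := by rw [← Finset.sum_mul, sum_workerWeight w hN, one_mul]

/-- The normal equations. -/
lemma bil_precision_wlse (hS : IsUnit (precision loss w z θhat)) (v : Vec p) :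
    bil (precision loss w z θhat) v (wlse loss w z θhat) =
      ∑ k, workerWeight w k * bil (localHess loss w z k (θhat k)) v (θhat k) := by
  simp only [bil, wlse]
  rw [Matrix.mulVec_mulVec, Matrix.mul_nonsing_inv _ ((Matrix.isUnit_iff_isUnit_det _).1 hS),
    Matrix.one_mulVec, dotProduct_sum]
  simp

lemma bil_precision_wlse_sub (hS : IsUnit (precision loss w z θhat)) (v : Vec p) :
    bil (precision loss w z θhat) v (wlse loss w z θhat - θ₀) =
      ∑ k, workerWeight w k * bil (localHess loss w z k (θhat k)) v (θhat k - θ₀) := by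
  rw [bil_sub_right, bil_precision_wlse hS, bil_precision, ← Finset.sum_sub_distrib]
  refine Finset.sum_congr rfl fun k _ => ?_
  rw [bil_sub_right, mul_sub]

/-- The error of the weighted least squares estimator is bounded by the score of the whole sample
and the squares of the local scores. -/
lemma norm_wlse_sub_le (g : Fin K → Fin p → ℝ) (hN : 0 < N) (hc : 0 < c) (hb : 0 ≤ b)
    (hsymm : ∀ k, ∀ u v : Vec p, bil (localHess loss w z k (θhat k)) u v =
      bil (localHess loss w z k (θhat k)) v u)
    (hH : ∀ k, ∀ v : Vec p, c * ‖v‖ ^ 2 ≤ bil (localHess loss w z k (θhat k)) v v)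
    (hexp : ∀ k, ∀ v : Vec p, |bil (localHess loss w z k (θhat k)) (θhat k - θ₀) v +
      ∑ i, v i * g k i| ≤ b * (‖θhat k - θ₀‖ ^ 2 * ‖v‖))
    (hclose : ∀ k, b * ‖θhat k - θ₀‖ ≤ c / 2) :
    ‖wlse loss w z θhat - θ₀‖ ≤ c⁻¹ * (∑ i, |∑ k, workerWeight w k * g k i| +
      b * (4 / c ^ 2) * (p * ∑ i, ∑ k, workerWeight w k * g k i ^ 2)) := by
  have hS := bil_precision_ge hN hH
  -- Testing the expansion with the error itself, `hclose` lets half of the curvature `c` absorb the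
  -- remainder; the other half bounds the error by the local score.
  have hloc : ∀ k, ‖θhat k - θ₀‖ ≤ 2 / c * ∑ i, |g k i| := fun k => by
    set x := θhat k - θ₀
    have h1 := hH k x
    have h2 := (abs_le.1 (hexp k x)).2
    have h3 := (abs_le.1 (abs_sum_coord_mul_le x (g k))).1
    have h4 : b * (‖x‖ ^ 2 * ‖x‖) ≤ c / 2 * ‖x‖ ^ 2 := by
      calc b * (‖x‖ ^ 2 * ‖x‖) = b * ‖x‖ * ‖x‖ ^ 2 := by ring
        _ ≤ _ := mul_le_mul_of_nonneg_right (hclose k) (by positivity)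
    have h5 : c / 2 * ‖x‖ ≤ ∑ i, |g k i| :=
      norm_le_of_quadratic_bound (by linarith) (Finset.sum_nonneg fun i _ => abs_nonneg _)
    rw [div_mul_eq_mul_div, le_div_iff₀ hc]
    linarith
  set u := wlse loss w z θhat - θ₀ with hu
  have hquad : ∑ k, workerWeight w k * ‖θhat k - θ₀‖ ^ 2 ≤
      4 / c ^ 2 * (p * ∑ i, ∑ k, workerWeight w k * g k i ^ 2) := by
    calc ∑ k, workerWeight w k * ‖θhat k - θ₀‖ ^ 2
        ≤ ∑ k, workerWeight w k * (4 / c ^ 2 * (p * ∑ i, g k i ^ 2)) := by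
          refine Finset.sum_le_sum fun k _ => mul_le_mul_of_nonneg_left ?_ (workerWeight_nonneg w k)
          calc ‖θhat k - θ₀‖ ^ 2 ≤ (2 / c * ∑ i, |g k i|) ^ 2 := by gcongr; exact hloc k
            _ = 4 / c ^ 2 * (∑ i, |g k i|) ^ 2 := by ring
            _ ≤ _ := by
                gcongr
                have := sq_sum_le_card_mul_sum_sq (s := Finset.univ) (f := fun i => |g k i|)
                simpa using this
      _ = _ := by
          rw [Finset.sum_comm (γ := Fin p), Finset.mul_sum, Finset.mul_sum]
          refine Finset.sum_congr rfl fun k _ => ?_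
          rw [← Finset.mul_sum]; ring
  -- The normal equations are tested with the error `u`. The terms linear in the local scores are
  -- summed over the workers before absolute values are taken, so that they combine into one
  -- weighted score; only the remainders are bounded worker by worker.
  have hT : bil (precision loss w z θhat) u u ≤ (∑ i, |∑ k, workerWeight w k * g k i| +
      b * (4 / c ^ 2) * (p * ∑ i, ∑ k, workerWeight w k * g k i ^ 2)) * ‖u‖ := by
    have h1 : ∀ k, bil (localHess loss w z k (θhat k)) u (θhat k - θ₀) ≤
        -(∑ i, u i * g k i) + b * (‖θhat k - θ₀‖ ^ 2 * ‖u‖) := fun k => by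
      rw [hsymm]
      linarith [(abs_le.1 (hexp k u)).2]
    have h2 := (abs_le.1 (abs_sum_coord_mul_le u fun i => ∑ k, workerWeight w k * g k i)).1
    have h3 : ∑ k, workerWeight w k * ∑ i, u i * g k i =
        ∑ i, u i * ∑ k, workerWeight w k * g k i := by
      simp only [Finset.mul_sum]
      rw [Finset.sum_comm]
      refine Finset.sum_congr rfl fun i _ => Finset.sum_congr rfl fun k _ => by ring
    calc bil (precision loss w z θhat) u u
        = ∑ k, workerWeight w k * bil (localHess loss w z k (θhat k)) u (θhat k - θ₀) :=
          bil_precision_wlse_sub (isUnit_of_bil_ge hc hS) u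
      _ ≤ ∑ k, workerWeight w k * (-(∑ i, u i * g k i) + b * (‖θhat k - θ₀‖ ^ 2 * ‖u‖)) :=
          Finset.sum_le_sum fun k _ => mul_le_mul_of_nonneg_left (h1 k) (workerWeight_nonneg w k)
      _ = -(∑ i, u i * ∑ k, workerWeight w k * g k i) +
          b * ‖u‖ * ∑ k, workerWeight w k * ‖θhat k - θ₀‖ ^ 2 := by
          rw [← h3, ← Finset.sum_neg_distrib, Finset.mul_sum, ← Finset.sum_add_distrib]
          refine Finset.sum_congr rfl fun k _ => by ring
      _ ≤ (∑ i, |∑ k, workerWeight w k * g k i|) * ‖u‖ +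
          b * ‖u‖ * (4 / c ^ 2 * (p * ∑ i, ∑ k, workerWeight w k * g k i ^ 2)) := by
          gcongr
          linarith
      _ = _ := by ring
  have hpos : 0 ≤ ∑ i, |∑ k, workerWeight w k * g k i| +
      b * (4 / c ^ 2) * (p * ∑ i, ∑ k, workerWeight w k * g k i ^ 2) := by
    have : 0 ≤ ∑ i, ∑ k, workerWeight w k * g k i ^ 2 := Finset.sum_nonneg fun i _ =>
      Finset.sum_nonneg fun k _ => mul_nonneg (workerWeight_nonneg w k) (sq_nonneg _)
    positivity
  have := norm_le_of_quadratic_bound ((hS u).trans hT) hpos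
  rwa [← div_eq_inv_mul, le_div_iff₀ hc, mul_comm]

/-- The weighted least squares objective is a quadratic centred at its minimizer. -/
lemma lsLoss_eq (hS : IsUnit (precision loss w z θhat))
    (hsymm : ∀ k, ∀ u v : Vec p, bil (localHess loss w z k (θhat k)) u v =
      bil (localHess loss w z k (θhat k)) v u) (θ : Vec p) :
    lsLoss loss w z θhat θ = quadForm (precision loss w z θhat) (θ - wlse loss w z θhat) +
      lsLoss loss w z θhat (wlse loss w z θhat) := by
  set a := wlse loss w z θhat
  -- The cross term vanishes by the normal equations.
  have h0 : ∑ k, workerWeight w k * bil (localHess loss w z k (θhat k)) (θ - a) (a - θhat k) = 0 := by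
    simp only [bil_sub_right _ _ a, mul_sub, Finset.sum_sub_distrib]
    rw [← bil_precision, bil_precision_wlse hS, sub_self]
  have h1 : ∀ k, workerWeight w k * quadForm (localHess loss w z k (θhat k)) (θ - θhat k) =
      workerWeight w k * bil (localHess loss w z k (θhat k)) (θ - a) (θ - a) +
      2 * (workerWeight w k * bil (localHess loss w z k (θhat k)) (θ - a) (a - θhat k)) +
      workerWeight w k * quadForm (localHess loss w z k (θhat k)) (a - θhat k) := fun k => by
    rw [quadForm_eq_bil, quadForm_eq_bil, show θ - θhat k = (θ - a) + (a - θhat k) by abel,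
      bil_add_left, bil_add_right, bil_add_right, hsymm k (a - θhat k) (θ - a)]
    ring
  simp only [lsLoss]
  rw [Finset.sum_congr rfl fun k _ => h1 k, Finset.sum_add_distrib, Finset.sum_add_distrib,
    ← Finset.mul_sum, h0, ← bil_precision, quadForm_eq_bil]
  ring

end Wlse

/-! ### Quadratic objectives with an adaptive lasso penalty -/

section Lasso

variable {p : ℕ} {S : Matrix (Fin p) (Fin p) ℝ} {a θ θ₀ : Vec p} {lam : Fin p → ℝ} {c C : ℝ}

lemma penalty_nonneg (hlam : ∀ j, 0 ≤ lam j) (θ : Vec p) : 0 ≤ ∑ j, lam j * |θ j| :=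
  Finset.sum_nonneg fun j _ => mul_nonneg (hlam j) (abs_nonneg _)

/-- A lasso estimate is known to minimize only where a minimizer exists; for nonnegative tuning,
coercivity provides one. -/
lemma exists_isMinOn_penalized (hc : 0 < c) (hS : ∀ v : Vec p, c * ‖v‖ ^ 2 ≤ bil S v v)
    (hlam : ∀ j, 0 ≤ lam j) (a : Vec p) :
    ∃ θ, IsMinOn (fun θ => quadForm S (θ - a) + ∑ j, lam j * |θ j|) Set.univ θ := by
  have hcont : Continuous fun θ : Vec p => quadForm S (θ - a) + ∑ j, lam j * |θ j| := by
    have := continuous_quadForm S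
    fun_prop
  have hlim : Tendsto (fun θ : Vec p => quadForm S (θ - a) + ∑ j, lam j * |θ j|)
      (cocompact (Vec p)) atTop := by
    have h1 : Tendsto (fun θ : Vec p => ‖θ - a‖) (cocompact (Vec p)) atTop :=
      (tendsto_norm_cocompact_atTop (E := Vec p)).comp
        (Homeomorph.subRight a).isClosedEmbedding.tendsto_cocompact
    have h2 : Tendsto (fun θ : Vec p => c * ‖θ - a‖ ^ 2) (cocompact (Vec p)) atTop :=
      ((tendsto_pow_atTop two_ne_zero).comp h1).const_mul_atTop hc
    refine tendsto_atTop_mono (fun θ => ?_) h2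
    have h3 := hS (θ - a)
    rw [← quadForm_eq_bil] at h3
    linarith [penalty_nonneg hlam θ]
  obtain ⟨θ, hθ⟩ := hcont.exists_forall_le hlim
  exact ⟨θ, fun x _ => hθ x⟩

lemma quadForm_le_of_isMinOn (hlam : ∀ j, 0 ≤ lam j)
    (hmin : IsMinOn (fun θ => quadForm S (θ - a) + ∑ j, lam j * |θ j|) Set.univ θ) (θ₀ : Vec p) :
    quadForm S (θ - a) ≤ quadForm S (θ₀ - a) + ∑ j, lam j * |θ₀ j| := by
  have h : quadForm S (θ - a) + ∑ j, lam j * |θ j| ≤ quadForm S (θ₀ - a) + ∑ j, lam j * |θ₀ j| :=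
    hmin (Set.mem_univ θ₀)
  linarith [penalty_nonneg hlam θ]

/-- A coordinate with a large penalty vanishes at the minimizer. -/
lemma coord_eq_zero_of_isMinOn (hsymm : ∀ u v : Vec p, bil S u v = bil S v u)
    (hC : ∀ u v : Vec p, |bil S u v| ≤ C * ‖u‖ * ‖v‖)
    (hmin : IsMinOn (fun θ => quadForm S (θ - a) + ∑ j, lam j * |θ j|) Set.univ θ) {j : Fin p}
    (hj : 2 * C * ‖θ - a‖ + C * |θ j| < lam j) : θ j = 0 := by
  by_contra hne
  set x := θ j with hx
  have hx0 : 0 < |x| := abs_pos.2 hne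
  have hnorm : ‖(stdVec j : Vec p)‖ = 1 := by simp [stdVec]
  -- Compare with `θ` after its `j`-th coordinate is set to zero: the penalty drops by `lam j *
  -- |x|`, while the quadratic rises by at most `|x| * (2 * C * ‖θ - a‖ + C * |x|)`, which is less.
  have h : quadForm S (θ - a) + ∑ i, lam i * |θ i| ≤
      quadForm S (θ - x • stdVec j - a) + ∑ i, lam i * |(θ - x • stdVec j) i| :=
    hmin (Set.mem_univ (θ - x • stdVec j))
  have h1 : quadForm S (θ - x • stdVec j - a) =
      quadForm S (θ - a) - 2 * (x * bil S (stdVec j) (θ - a)) +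
        x ^ 2 * bil S (stdVec j) (stdVec j) := by
    rw [quadForm_eq_bil, quadForm_eq_bil, sub_right_comm]
    generalize θ - a = y
    simp only [bil_sub_left, bil_sub_right, bil_smul_left, bil_smul_right, hsymm y (stdVec j)]
    ring
  have h2 : ∑ i, lam i * |(θ - x • stdVec j) i| = ∑ i, lam i * |θ i| - lam j * |x| := by
    rw [← Finset.add_sum_erase _ _ (Finset.mem_univ j),
      ← Finset.add_sum_erase _ (fun i => lam i * |θ i|) (Finset.mem_univ j)]
    have e : ∑ i ∈ Finset.univ.erase j, lam i * |(θ - x • stdVec j) i| =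
        ∑ i ∈ Finset.univ.erase j, lam i * |θ i| := Finset.sum_congr rfl fun i hi => by
      have : i ≠ j := Finset.ne_of_mem_erase hi
      simp [stdVec, this]
    rw [e]
    simp [stdVec, hx]
  have h3 : -(x * bil S (stdVec j) (θ - a)) ≤ |x| * (C * ‖θ - a‖) := by
    refine (neg_le_abs _).trans ?_
    rw [abs_mul]
    have := hC (stdVec j) (θ - a)
    rw [hnorm, mul_one] at this
    gcongr
  have h4 : x ^ 2 * bil S (stdVec j) (stdVec j) ≤ |x| * (C * |x|) := by
    have := (le_abs_self _).trans (hC (stdVec j) (stdVec j))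
    rw [hnorm, mul_one, mul_one] at this
    calc x ^ 2 * bil S (stdVec j) (stdVec j) ≤ x ^ 2 * C := by gcongr
      _ = |x| * (C * |x|) := by rw [← sq_abs]; ring
  have h5 : |x| * (2 * C * ‖θ - a‖ + C * |x|) < |x| * lam j := mul_lt_mul_of_pos_left hj hx0
  rw [h1, h2] at h
  nlinarith

end Lasso

/-! ### The criterion -/

section Criterion

variable {p d₀ : ℕ}

lemma card_trueModel (h : d₀ < p) : (trueModel p d₀).card = d₀ := by
  have := Fin.card_filter_val_lt (n := p) (m := d₀)
  rw [trueModel, this, min_eq_right h.le]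

lemma refTuning_nonneg (p d₀ N : ℕ) (j : Fin p) : 0 ≤ refTuning p d₀ N j := by
  have := Real.log_natCast_nonneg N
  unfold refTuning; split_ifs <;> positivity

variable {N K : ℕ} {loss : Vec p → Obs p → ℝ} {w : Fin N → Fin K} {z : Fin N → Obs p}
  {θhat : Fin K → Vec p} {θ θ₀ : Vec p} {c C κ β : ℝ}

/-- The criterion is large at an estimate with a wrong model. -/
lemma dbic_ge_of_model_ne (hd : d₀ < p) (hN : 0 < N) (hc : 0 < c)
    (hS : ∀ v : Vec p, c * ‖v‖ ^ 2 ≤ bil (precision loss w z θhat) v v)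
    (hβ : ∀ j : Fin p, (j : ℕ) < d₀ → β ≤ |θ₀ j|) (hβ0 : 0 < β)
    (hw : ‖wlse loss w z θhat - θ₀‖ ≤ β / 2)
    (hr : critRate N ^ 2 * (d₀ + 1) ≤ c * (β / 2) ^ 2)
    (hθ : model θ ≠ trueModel p d₀) :
    critRate N ^ 2 * (d₀ + 1) ≤ dbic loss w z θhat θ := by
  have hlog := Real.log_natCast_nonneg N
  have hNr : (0 : ℝ) < N := by exact_mod_cast hN
  have hq := hS (θ - wlse loss w z θhat)
  rw [← quadForm_eq_bil] at hq
  unfold dbic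
  -- A proper superset of the true model is settled by the penalty alone, a missing true coordinate
  -- by the quadratic term alone.
  by_cases hsub : trueModel p d₀ ⊆ model θ
  · have hcard : d₀ + 1 ≤ (model θ).card := by
      have := Finset.card_lt_card (hsub.ssubset_of_ne hθ.symm)
      rwa [card_trueModel hd] at this
    have hcard' : (d₀ + 1 : ℝ) ≤ (model θ).card := by exact_mod_cast hcard
    have h1 : critRate N ^ 2 * (d₀ + 1) ≤ Real.log N * ((model θ).card : ℝ) / N := by
      rw [critRate_sq, div_mul_eq_mul_div]
      gcongr
    have h2 : 0 ≤ c * ‖θ - wlse loss w z θhat‖ ^ 2 := by positivity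
    linarith
  · obtain ⟨j, hj, hjθ⟩ := Finset.not_subset.1 hsub
    have hj' : (j : ℕ) < d₀ := by simpa [trueModel] using hj
    have hθj : θ j = 0 := by simpa [model] using hjθ
    have h1 := norm_coord_le (θ - wlse loss w z θhat) j
    have h2 := norm_coord_le (wlse loss w z θhat - θ₀) j
    rw [PiLp.sub_apply] at h1 h2
    rw [hθj, zero_sub, abs_neg] at h1
    have h3 : |θ₀ j| ≤ |wlse loss w z θhat j| + |wlse loss w z θhat j - θ₀ j| := by
      have := abs_sub_abs_le_abs_sub (θ₀ j) (wlse loss w z θhat j)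
      rw [abs_sub_comm] at this
      linarith
    have h4 : β / 2 ≤ ‖θ - wlse loss w z θhat‖ := by linarith [hβ j hj']
    have h5 : c * (β / 2) ^ 2 ≤ c * ‖θ - wlse loss w z θhat‖ ^ 2 := by gcongr
    have h6 : 0 ≤ Real.log N * ((model θ).card : ℝ) / N := by positivity
    linarith

/-- The criterion is small at the estimate with the reference tuning. -/
lemma dbic_le_of_isMinOn_refTuning (hd : d₀ < p) (hN : 1 < N) (hc : 0 < c) (hC0 : 0 ≤ C)
    (hκ0 : 0 ≤ κ)
    (hsymm : ∀ u v : Vec p, bil (precision loss w z θhat) u v =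
      bil (precision loss w z θhat) v u)
    (hS : ∀ v : Vec p, c * ‖v‖ ^ 2 ≤ bil (precision loss w z θhat) v v)
    (hC : ∀ u v : Vec p, |bil (precision loss w z θhat) u v| ≤ C * ‖u‖ * ‖v‖)
    (hθ₀ : ∀ j : Fin p, ¬ (j : ℕ) < d₀ → θ₀ j = 0)
    (hw : ‖wlse loss w z θhat - θ₀‖ ≤ κ * critRate N)
    (hκ : C * κ ^ 2 ≤ 1 / 4) (hb : ∑ j, |θ₀ j| ≤ Real.log N / 4)
    (hlarge : 3 * C * Real.sqrt c⁻¹ + C * κ < Real.sqrt (Real.log N))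
    (hmin : IsMinOn (fun θ => quadForm (precision loss w z θhat) (θ - wlse loss w z θhat) +
      ∑ j, refTuning p d₀ N j * |θ j|) Set.univ θ) :
    dbic loss w z θhat θ < critRate N ^ 2 * (d₀ + 1) := by
  set a := wlse loss w z θhat
  set r := critRate N with hr_def
  have hr := critRate_pos hN
  have hNr : (0 : ℝ) < N := by positivity
  have hlog : 0 < Real.log N := Real.log_pos (by exact_mod_cast hN)
  have hr2 : r ^ 2 = Real.log N / N := critRate_sq N
  -- Comparison with `θ₀`: its quadratic term is at most C κ² r² ≤ r²/4, and its penalty involves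
  -- only the weights 1/N, so it is at most log N / (4N) = r²/4.
  have hquad : quadForm (precision loss w z θhat) (θ - a) ≤ r ^ 2 / 2 := by
    have h1 := quadForm_le_of_isMinOn (refTuning_nonneg p d₀ N) hmin θ₀
    have h2 : ∑ j, refTuning p d₀ N j * |θ₀ j| = (∑ j, |θ₀ j|) / N := by
      rw [Finset.sum_div]
      refine Finset.sum_congr rfl fun j _ => ?_
      by_cases hj : (j : ℕ) < d₀
      · simp [refTuning, hj]; ring
      · simp [hθ₀ j hj]
    have h3 : (∑ j, |θ₀ j|) / N ≤ r ^ 2 / 4 := by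
      rw [hr2, div_right_comm]; gcongr
    have h4 : quadForm (precision loss w z θhat) (θ₀ - a) ≤ r ^ 2 / 4 := by
      have h5 := (le_abs_self _).trans (hC (θ₀ - a) (θ₀ - a))
      rw [← quadForm_eq_bil, norm_sub_rev] at h5
      calc _ ≤ _ := h5
        _ ≤ C * (κ * r) * (κ * r) := by gcongr
        _ = C * κ ^ 2 * r ^ 2 := by ring
        _ ≤ 1 / 4 * r ^ 2 := by gcongr
        _ = _ := by ring
    linarith
  have hdist : ‖θ - a‖ ≤ Real.sqrt c⁻¹ * r := by
    have h1 := hS (θ - a)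
    rw [← quadForm_eq_bil] at h1
    refine abs_le_of_sq_le_sq' ?_ (by positivity) |>.2
    rw [mul_pow, Real.sq_sqrt (by positivity), ← div_eq_inv_mul, le_div_iff₀ hc, mul_comm]
    have : 0 ≤ r ^ 2 := by positivity
    linarith
  -- Off the true model the weight is √(log N) · r. The factor 3 in `hlarge` counts ‖θ - a‖ twice
  -- from the slope and once from |θ j| ≤ ‖θ - a‖ + κ r.
  have hmodel : model θ ⊆ trueModel p d₀ := by
    intro j hj
    by_contra hjT
    have hj' : ¬ (j : ℕ) < d₀ := by simpa [trueModel] using hjT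
    refine (by simpa [model] using hj : θ j ≠ 0) (coord_eq_zero_of_isMinOn hsymm hC hmin ?_)
    have h1 := norm_coord_le (θ - a) j
    have h2 := norm_coord_le (a - θ₀) j
    rw [PiLp.sub_apply] at h1 h2
    rw [hθ₀ j hj', sub_zero] at h2
    have h3 : |θ j| ≤ Real.sqrt c⁻¹ * r + κ * r := by
      have := abs_sub_abs_le_abs_sub (θ j) (a j)
      linarith
    have hrate : r = Real.sqrt (Real.log N) / Real.sqrt N := Real.sqrt_div hlog.le _
    calc 2 * C * ‖θ - a‖ + C * |θ j|
        ≤ 2 * C * (Real.sqrt c⁻¹ * r) + C * (Real.sqrt c⁻¹ * r + κ * r) := by gcongr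
      _ = (3 * C * Real.sqrt c⁻¹ + C * κ) * r := by ring
      _ < Real.sqrt (Real.log N) * r := by gcongr
      _ = refTuning p d₀ N j := by
          rw [hrate, ← mul_div_assoc, Real.mul_self_sqrt hlog.le]
          simp [refTuning, hj']
  have hcard : ((model θ).card : ℝ) ≤ d₀ := by
    have := Finset.card_le_card hmodel
    rw [card_trueModel hd] at this
    exact_mod_cast this
  have h1 : Real.log N * ((model θ).card : ℝ) / N ≤ r ^ 2 * d₀ := by
    rw [hr2, div_mul_eq_mul_div]; gcongr
  have h2 : 0 < r ^ 2 := by positivity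
  unfold dbic
  linarith

end Criterion

/-! ### Bounds that are uniform over the workers -/

section Moments

variable {S : Type*} [MeasurableSpace S] {ν : Measure S} {f : S → ℝ}
  {C : ℝ≥0}

lemma integral_sq_le_of_eLpNorm_two_le (hf : AEStronglyMeasurable f ν) (h : eLpNorm f 2 ν ≤ C) :
    ∫ x, f x ^ 2 ∂ν ≤ (C : ℝ) ^ 2 := by
  have hm : MemLp f 2 ν := ⟨hf, h.trans_lt ENNReal.coe_lt_top⟩
  have h1 := hm.eLpNorm_eq_integral_rpow_norm (by simp) (by simp)
  rw [h1, ENNReal.ofReal_le_iff_le_toReal ENNReal.coe_ne_top, ENNReal.coe_toReal] at h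
  have h0 : 0 ≤ ∫ x, f x ^ 2 ∂ν := integral_nonneg fun x => sq_nonneg _
  simp only [ENNReal.toReal_ofNat, Real.rpow_two, Real.norm_eq_abs, sq_abs] at h
  rw [← one_div, ← Real.sqrt_eq_rpow] at h
  exact (Real.sqrt_le_left C.coe_nonneg).1 h

variable [IsProbabilityMeasure ν]

lemma abs_integral_le_of_eLpNorm_two_le (hf : AEStronglyMeasurable f ν) (h : eLpNorm f 2 ν ≤ C) :
    |∫ x, f x ∂ν| ≤ C := by
  have h1 : eLpNorm f 1 ν ≤ C := (eLpNorm_le_eLpNorm_of_exponent_le one_le_two hf).trans h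
  have hi : Integrable f ν := memLp_one_iff_integrable.1 ⟨hf, h1.trans_lt ENNReal.coe_lt_top⟩
  have h2 : eLpNorm f 1 ν = ENNReal.ofReal (∫ x, ‖f x‖ ∂ν) := by
    rw [eLpNorm_one_eq_lintegral_enorm, ofReal_integral_norm_eq_lintegral_enorm hi]
  rw [h2, ENNReal.ofReal_le_iff_le_toReal ENNReal.coe_ne_top, ENNReal.coe_toReal] at h1
  exact abs_integral_le_integral_abs.trans h1

end Moments

section InfoMatrix

variable {p : ℕ} {loss : Vec p → Obs p → ℝ} {θ₀ : Vec p} {ν : Measure (Obs p)}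

lemma infoMatrix_isHermitian : (infoMatrix loss ν θ₀).IsHermitian := by
  ext i j
  simp [infoMatrix, mul_comm]

/-- The form is the second moment of a linear combination of the scores. Together with
nonsingularity this makes the information matrix positive definite. -/
lemma bil_infoMatrix_nonneg (h : ∀ i, MemLp (fun z => dLoss loss θ₀ z i) 2 ν) (v : Vec p) :
    0 ≤ bil (infoMatrix loss ν θ₀) v v := by
  have hint : ∀ i j, Integrable (fun z => v i * (dLoss loss θ₀ z i * dLoss loss θ₀ z j * v j)) ν :=
    fun i j => (((h i).integrable_mul (h j)).mul_const _).const_mul _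
  have : bil (infoMatrix loss ν θ₀) v v = ∫ z, (∑ i, v i * dLoss loss θ₀ z i) ^ 2 ∂ν := by
    simp_rw [bil_eq_sum, infoMatrix, Matrix.of_apply, ← integral_mul_const, ← integral_const_mul]
    simp_rw [← integral_finsetSum _ fun j _ => hint _ j]
    rw [← integral_finsetSum _ fun i _ => integrable_finsetSum _ fun j _ => hint i j]
    congr 1
    ext z
    rw [pow_two, Finset.sum_mul_sum]
    refine Finset.sum_congr rfl fun i _ => Finset.sum_congr rfl fun j _ => by ring
  rw [this]
  exact integral_nonneg fun z => sq_nonneg _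

lemma exists_pos_bil_ge {A : Matrix (Fin p) (Fin p) ℝ} (hA : A.PosDef) :
    ∃ c > 0, ∀ v : Vec p, c * ‖v‖ ^ 2 ≤ bil A v v := by
  -- The sphere is empty when `p = 0`; otherwise the constant is the minimum of the form on it.
  rcases (Metric.sphere (0 : Vec p) 1).eq_empty_or_nonempty with he | hne
  · refine ⟨1, one_pos, fun v => ?_⟩
    have hv : v = 0 := by
      by_contra hv
      have : ‖v‖⁻¹ • v ∈ Metric.sphere (0 : Vec p) 1 := by
        simp [norm_smul, inv_mul_cancel₀ (norm_ne_zero_iff.2 hv)]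
      rw [he] at this
      exact this
    simp [hv, bil]
  · obtain ⟨u, hu, hmin⟩ := (isCompact_sphere (0 : Vec p) 1).exists_isMinOn hne
      (continuous_quadForm A).continuousOn
    have hu1 : ‖u‖ = 1 := by simpa using hu
    have hu0 : u.ofLp ≠ 0 := fun h => by
      have : u = 0 := by ext i; simp [h]
      simp [this] at hu1
    have hpos : 0 < quadForm A u := by simpa [quadForm] using hA.dotProduct_mulVec_pos hu0
    refine ⟨quadForm A u, hpos, fun v => ?_⟩
    rcases eq_or_ne v 0 with rfl | hv
    · simp [bil]
    · have hn := norm_ne_zero_iff.2 hv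
      have hm : ‖v‖⁻¹ • v ∈ Metric.sphere (0 : Vec p) 1 := by
        simp [norm_smul, inv_mul_cancel₀ hn]
      have h : quadForm A u ≤ quadForm A (‖v‖⁻¹ • v) := hmin hm
      rw [quadForm_eq_bil A (‖v‖⁻¹ • v), bil_smul_left, bil_smul_right] at h
      calc quadForm A u * ‖v‖ ^ 2 ≤ ‖v‖⁻¹ * (‖v‖⁻¹ * bil A v v) * ‖v‖ ^ 2 := by gcongr
        _ = bil A v v := by field_simp

lemma exists_forall_lt_le (g : ℕ → ℝ) (n : ℕ) : ∃ D, ∀ k < n, g k ≤ D := by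
  obtain ⟨D, hD⟩ := ((Finset.range n).image g).bddAbove
  exact ⟨D, fun k hk => hD (by simpa using ⟨k, hk, rfl⟩)⟩

lemma exists_pos_forall_lt_le {g : ℕ → ℝ} (hg : ∀ k, 0 < g k) (n : ℕ) :
    ∃ c > 0, ∀ k < n, c ≤ g k := by
  obtain ⟨D, hD⟩ := exists_forall_lt_le (fun k => (g k)⁻¹) n
  refine ⟨(max D 1)⁻¹, by positivity, fun k hk => ?_⟩
  rw [inv_le_comm₀ (by positivity) (hg k)]
  exact (hD k hk).trans (le_max_left _ _)

end InfoMatrix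

section Uniform

variable {p : ℕ} {Ω : Type*} [MeasurableSpace Ω] {P : Measure Ω}
  {K : ℕ → ℕ} {w : (N : ℕ) → Fin N → Fin (K N)} {Z : (N : ℕ) → Fin N → Ω → Obs p}
  {ν : ℕ → Measure (Obs p)}
  {loss : Vec p → Obs p → ℝ} {Θ : Set (Vec p)} {θ₀ : Vec p}
  {M : Fin p → Fin p → Fin p → Obs p → ℝ}

/-- The smoothness ball is shrunk into `Θ`, where estimates are interior points, and the almost sure
statement is carried from the laws `ν k` to the sample. -/
lemma exists_ball_smoothObs (hC1 : CondParameterSpace Θ θ₀) (hS : CondSampling P K w Z ν)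
    (hC5 : CondSmooth ν loss Θ θ₀ M) : ∃ δ > 0, Metric.ball θ₀ δ ⊆ Θ ∧
      ∀ N, ∀ᵐ ω ∂P, ∀ i, SmoothObs loss θ₀ δ M (Z N i ω) := by
  obtain ⟨δ₁, hδ₁, hsm⟩ := hC5.1
  obtain ⟨δ₂, hδ₂, hball⟩ := Metric.mem_nhds_iff.1 (mem_interior_iff_mem_nhds.1 hC1.2.2)
  have hsub : Metric.ball θ₀ (min δ₁ δ₂) ⊆ Θ :=
    (Metric.ball_subset_ball (min_le_right _ _)).trans hball
  refine ⟨min δ₁ δ₂, lt_min hδ₁ hδ₂, hsub, fun N => ae_all_iff.2 fun i => ?_⟩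
  have hl := (hS N).2 i
  have h := hsm (w N i)
  rw [← hl.map_eq] at h
  filter_upwards [ae_of_ae_map hl.aemeasurable h] with ω hω θ hθ
  refine hω θ (hsub hθ) ?_
  rw [← dist_eq_norm]
  exact (hθ.trans_le (min_le_left _ _)).le

/-- Consistency of the local estimators, uniformly over the workers. -/
lemma highProb_norm_localEstimator_sub_lt (hC1 : CondParameterSpace Θ θ₀)
    (hC3 : CondIdentifiable P K w Z ν loss Θ θ₀)
    {θhat : (N : ℕ) → Ω → Fin (K N) → Vec p}
    (hθhat : ∀ N, ∀ᵐ ω ∂P, ∀ k, θhat N ω k ∈ Θ ∧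
      IsMinOn (localLoss loss (w N) (fun i => Z N i ω) k) Θ (θhat N ω k))
    {δ : ℝ} (hδ : 0 < δ) :
    HighProb P fun N ω => ∀ k, ‖θhat N ω k - θ₀‖ < δ := by
  obtain ⟨ε, hε, h⟩ := hC3.1 δ hδ
  refine h.mono (Eventually.of_forall fun N => ?_)
  filter_upwards [hθhat N] with ω hω hid k
  by_contra! hcon
  have h1 := hid k _ (hω k).1 hcon
  have h2 : localLoss loss (w N) (fun i => Z N i ω) k (θhat N ω k) ≤
      localLoss loss (w N) (fun i => Z N i ω) k θ₀ := (hω k).2 (interior_subset hC1.2.2)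
  linarith

variable [IsProbabilityMeasure P] [∀ k, IsProbabilityMeasure (ν k)]

/-- The information matrices and the means of the dominating functions are bounded over the
workers. -/
lemma exists_uniform_bounds (hC4 : CondLocalConvexity ν loss θ₀)
    (hC5 : CondSmooth ν loss Θ θ₀ M) (hU : CondUniform K ν loss θ₀ M) :
    ∃ c D : ℝ, 0 < c ∧ 0 ≤ D ∧ ∀ N, ∀ k : Fin (K N),
      (∀ v : Vec p, c * ‖v‖ ^ 2 ≤ bil (infoMatrix loss (ν k) θ₀) v v) ∧
      (∀ i j, |infoMatrix loss (ν k) θ₀ i j| ≤ D) ∧ ∀ i j l, ∫ z, M i j l z ∂ν k ≤ D := by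
  rcases hU with ⟨K₀, hK⟩ | ⟨c, C, hc, h⟩
  · have hpd : ∀ k, (infoMatrix loss (ν k) θ₀).PosDef := fun k => by
      refine (Matrix.PosSemidef.of_dotProduct_mulVec_nonneg infoMatrix_isHermitian
        fun x => ?_).posDef_iff_isUnit.2 (hC4 k).2.2.2
      simpa [bil] using bil_infoMatrix_nonneg (hC4 k).1 (WithLp.toLp 2 x)
    choose c hc hcb using fun k => exists_pos_bil_ge (hpd k)
    obtain ⟨c', hc', hcc⟩ := exists_pos_forall_lt_le hc K₀
    obtain ⟨D₁, hD₁⟩ := exists_forall_lt_le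
      (fun k => ∑ i, ∑ j, |infoMatrix loss (ν k) θ₀ i j|) K₀
    obtain ⟨D₂, hD₂⟩ := exists_forall_lt_le
      (fun k => ∑ i, ∑ j, ∑ l, |∫ z, M i j l z ∂ν k|) K₀
    refine ⟨c', max 0 (max D₁ D₂), hc', le_max_left _ _, fun N k => ?_⟩
    have hk : (k : ℕ) < K₀ := k.2.trans_le (hK N)
    refine ⟨fun v => le_trans ?_ (hcb k v), fun i j => ?_, fun i j l => ?_⟩
    · gcongr; exact hcc k hk
    · refine le_trans ?_ ((hD₁ k hk).trans ((le_max_left _ _).trans (le_max_right _ _)))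
      refine le_trans ?_ (Finset.single_le_sum (f := fun i => ∑ j, |infoMatrix loss (ν k) θ₀ i j|)
        (fun i _ => Finset.sum_nonneg fun j _ => abs_nonneg _) (Finset.mem_univ i))
      exact Finset.single_le_sum (f := fun j => |infoMatrix loss (ν k) θ₀ i j|)
        (fun j _ => abs_nonneg _) (Finset.mem_univ j)
    · refine le_trans ?_ ((hD₂ k hk).trans ((le_max_right _ _).trans (le_max_right _ _)))
      refine le_trans ?_ (Finset.single_le_sum
        (f := fun i => ∑ j, ∑ l, |∫ z, M i j l z ∂ν k|)
        (fun i _ => Finset.sum_nonneg fun j _ => Finset.sum_nonneg fun l _ => abs_nonneg _)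
        (Finset.mem_univ i))
      refine le_trans ?_ (Finset.single_le_sum (f := fun j => ∑ l, |∫ z, M i j l z ∂ν k|)
        (fun j _ => Finset.sum_nonneg fun l _ => abs_nonneg _) (Finset.mem_univ j))
      exact (le_abs_self _).trans (Finset.single_le_sum (f := fun l => |∫ z, M i j l z ∂ν k|)
        (fun l _ => abs_nonneg _) (Finset.mem_univ l))
  -- The entries of the information matrix are means of second derivatives, so L² bounds control
  -- them and the means of `M`.
  · refine ⟨c, C, hc, C.coe_nonneg, fun N k => ⟨fun v => (h k).1 v, fun i j => ?_, fun i j l => ?_⟩⟩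
    · rw [(hC4 k).2.2.1 i j]
      exact abs_integral_le_of_eLpNorm_two_le ((hC4 k).2.1 i j).aestronglyMeasurable
        ((h k).2.2.1 i j)
    · exact (le_abs_self _).trans (abs_integral_le_of_eLpNorm_two_le
        (hC5.2 k i j l).aestronglyMeasurable ((h k).2.2.2 i j l))

lemma highProb_hess_and_bound (hW : CondWorkers K w) (hS : CondSampling P K w Z ν)
    (hC4 : CondLocalConvexity ν loss θ₀) (hC5 : CondSmooth ν loss Θ θ₀ M)
    (hU : CondUniform K ν loss θ₀ M) {ε : ℝ} (hε : 0 < ε) :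
    HighProb P fun N ω =>
      (∀ i j, ∀ k : Fin (K N), |workerMean (w N) (fun i => Z N i ω) k
        (fun x => d2Loss loss θ₀ x i j) - infoMatrix loss (ν k) θ₀ i j| ≤ ε) ∧
      ∀ i j l, ∀ k : Fin (K N),
        |workerMean (w N) (fun i => Z N i ω) k (M i j l) - ∫ z, M i j l z ∂ν k| ≤ ε := by
  have hI : ∀ k i j, infoMatrix loss (ν k) θ₀ i j = ∫ z, d2Loss loss θ₀ z i j ∂ν k :=
    fun k => (hC4 k).2.2.1
  simp_rw [hI]
  rcases hU with ⟨K₀, hK⟩ | ⟨c, C, hc, h⟩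
  · refine (highProb_forall fun i => highProb_forall fun j => ?_).and
      (highProb_forall fun i => highProb_forall fun j => highProb_forall fun l => ?_)
    · exact highProb_workerMean_of_bounded hW hS hK (fun k => (hC4 k).2.1 i j) hε
    · exact highProb_workerMean_of_bounded hW hS hK (fun k => hC5.2 k i j l) hε
  · refine (highProb_forall fun i => highProb_forall fun j => ?_).and
      (highProb_forall fun i => highProb_forall fun j => highProb_forall fun l => ?_)
    · have hm := fun k => ((hC4 k).2.1 i j).aestronglyMeasurable
      exact highProb_workerMean_of_memLp_two hW hS
        (fun k => ⟨hm k, ((h k).2.2.1 i j).trans_lt ENNReal.coe_lt_top⟩)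
        (fun k => integral_sq_le_of_eLpNorm_two_le (hm k) ((h k).2.2.1 i j)) hε
    · have hm := fun k => (hC5.2 k i j l).aestronglyMeasurable
      exact highProb_workerMean_of_memLp_two hW hS
        (fun k => ⟨hm k, ((h k).2.2.2 i j l).trans_lt ENNReal.coe_lt_top⟩)
        (fun k => integral_sq_le_of_eLpNorm_two_le (hm k) ((h k).2.2.2 i j l)) hε

/-- With probability tending to one the local Hessians are symmetric, bounded and bounded away from
singularity, and the error of the weighted least squares estimator is of a smaller order than
`√(log N / N)`. -/
lemma exists_highProb_wlse (hp : 0 < p) (hW : CondWorkers K w)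
    (hC1 : CondParameterSpace Θ θ₀) (hS : CondSampling P K w Z ν)
    (hC3 : CondIdentifiable P K w Z ν loss Θ θ₀) (hC4 : CondLocalConvexity ν loss θ₀)
    (hC5 : CondSmooth ν loss Θ θ₀ M) (hU : CondUniform K ν loss θ₀ M)
    {θhat : (N : ℕ) → Ω → Fin (K N) → Vec p}
    (hθhat : ∀ N, ∀ᵐ ω ∂P, ∀ k, θhat N ω k ∈ Θ ∧
      IsMinOn (localLoss loss (w N) (fun i => Z N i ω) k) Θ (θhat N ω k)) :
    ∃ c C : ℝ, 0 < c ∧ 0 < C ∧ ∀ κ > 0, HighProb P fun N ω =>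
      (∀ k, ∀ u v : Vec p,
        bil (localHess loss (w N) (fun i => Z N i ω) k (θhat N ω k)) u v =
          bil (localHess loss (w N) (fun i => Z N i ω) k (θhat N ω k)) v u) ∧
      (∀ k, ∀ v : Vec p,
        c * ‖v‖ ^ 2 ≤ bil (localHess loss (w N) (fun i => Z N i ω) k (θhat N ω k)) v v) ∧
      (∀ k, ∀ u v : Vec p,
        |bil (localHess loss (w N) (fun i => Z N i ω) k (θhat N ω k)) u v| ≤ C * ‖u‖ * ‖v‖) ∧
      ‖wlse loss (w N) (fun i => Z N i ω) (θhat N ω) - θ₀‖ ≤ κ * critRate N := by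
  obtain ⟨c₀, D, hc₀, hD, hbd⟩ := exists_uniform_bounds hC4 hC5 hU
  obtain ⟨δ, hδ, hΘ, hsmooth⟩ := exists_ball_smoothObs hC1 hS hC5
  obtain ⟨c₁, hc₁, hsize⟩ := hW.exists_le
  have hp' : (0 : ℝ) < p := by exact_mod_cast hp
  -- The constants split the allowed loss of curvature c = c₀/2: sampling error of the Hessian at
  -- `θ₀` costs p² e = c/2, and moving to the estimate, within c₀/(4b) of `θ₀`, costs another c/2.
  -- Here `b` bounds the sum of the p³ local means of the dominating functions.
  set e : ℝ := c₀ / (4 * p ^ 2) with he_def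
  have he : 0 < e := by positivity
  set b : ℝ := p ^ 3 * (D + e) with hb_def
  have hb : 0 < b := by positivity
  set c : ℝ := c₀ / 2 with hc_def
  have hc : 0 < c := by positivity
  refine ⟨c, p ^ 2 * D + c, hc, by positivity, fun κ hκ => ?_⟩
  -- The factor by which `norm_wlse_sub_le` inflates a common bound on its 2p score terms; each is
  -- therefore asked to be at most (κ / A) r.
  set A : ℝ := c⁻¹ * (p + b * (4 / c ^ 2) * (p * p)) with hA_def
  have hA : 0 < A := by positivity
  -- Second moments of the scores are the diagonal entries of the information matrix.
  have hscore2 : ∀ N, ∀ k : Fin (K N), ∀ i, ∫ x, dLoss loss θ₀ x i ^ 2 ∂ν k ≤ D := fun N k i => by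
    have h := (le_abs_self _).trans ((hbd N k).2.1 i i)
    simpa [infoMatrix, pow_two] using h
  have ev1 := highProb_hess_and_bound hW hS hC4 hC5 hU he
  have ev2 := highProb_norm_localEstimator_sub_lt hC1 hC3 hθhat
    (show 0 < min δ (c₀ / (4 * b)) by positivity)
  have ev3 := highProb_forall fun i => highProb_mean_le hS (fun k => (hC4 k).1 i)
    (fun k => (hC3.2 k i).2) (fun N k => hscore2 N k i) (show 0 < κ / A by positivity)
  have ev4 := highProb_forall fun i => highProb_sum_workerMean_sq_le hW hS
    (fun k => (hC4 k).1 i) (fun k => (hC3.2 k i).2) (fun N k => hscore2 N k i)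
    (show 0 < κ / A by positivity)
  refine ((ev1.and ev2).and (ev3.and ev4)).mono ?_
  filter_upwards [eventually_gt_atTop 0] with N hN
  filter_upwards [hsmooth N, hθhat N] with ω hsm hmin
  rintro ⟨⟨⟨hhess, hM⟩, hcl⟩, hmean, hsq⟩
  have hball : ∀ k, θhat N ω k ∈ Metric.ball θ₀ δ := fun k => by
    rw [mem_ball_iff_norm]; exact (hcl k).trans_le (min_le_left _ _)
  have hbound : ∀ k, workerMean (w N) (fun i => Z N i ω) k (totalBound M) ≤ b := fun k => by
    have h1 : workerMean (w N) (fun i => Z N i ω) k (totalBound M) =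
        ∑ i, ∑ j, ∑ l, workerMean (w N) (fun i => Z N i ω) k (M i j l) := by
      change workerMean (w N) (fun i => Z N i ω) k (fun x => ∑ i, ∑ j, ∑ l, M i j l x) = _
      simp_rw [workerMean_sum]
    rw [h1]
    calc _ ≤ ∑ _i : Fin p, ∑ _j : Fin p, ∑ _l : Fin p, (D + e) := by
          refine Finset.sum_le_sum fun i _ => Finset.sum_le_sum fun j _ =>
            Finset.sum_le_sum fun l _ => ?_
          linarith [(abs_le.1 (hM i j l k)).2, (hbd N k).2.2 i j l]
      _ = b := by simp [hb_def]; ring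
  have hdiff : ∀ k, ∀ u v : Vec p,
      |bil (localHess loss (w N) (fun i => Z N i ω) k (θhat N ω k)) u v -
        bil (infoMatrix loss (ν k) θ₀) u v| ≤ c * (‖u‖ * ‖v‖) := fun k u v => by
    have h1 := abs_bil_localHess_sub_le (w := w N) (k := k) hsm (hball k) u v
    have h2 := abs_bil_le (localHess loss (w N) (fun i => Z N i ω) k θ₀ -
      infoMatrix loss (ν k) θ₀) u v (e := e) fun i j => by
        rw [Matrix.sub_apply, localHess_apply]
        exact hhess i j k
    rw [bil_sub_matrix] at h2
    have h3 : workerMean (w N) (fun i => Z N i ω) k (totalBound M) *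
        (‖θhat N ω k - θ₀‖ * ‖u‖ * ‖v‖) ≤ c / 2 * (‖u‖ * ‖v‖) := by
      calc _ ≤ b * (c₀ / (4 * b) * ‖u‖ * ‖v‖) := by
            gcongr
            · exact hbound k
            · exact (hcl k).le.trans (min_le_right _ _)
        _ = c / 2 * (‖u‖ * ‖v‖) := by rw [hc_def]; field_simp; ring
    have h4 : (p : ℝ) ^ 2 * e * ‖u‖ * ‖v‖ = c / 2 * (‖u‖ * ‖v‖) := by
      rw [he_def, hc_def]; field_simp; ring
    rw [h4] at h2
    have h5 := abs_sub_le (bil (localHess loss (w N) (fun i => Z N i ω) k (θhat N ω k)) u v)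
      (bil (localHess loss (w N) (fun i => Z N i ω) k θ₀) u v) (bil (infoMatrix loss (ν k) θ₀) u v)
    linarith
  have hsymm : ∀ k, ∀ u v : Vec p,
      bil (localHess loss (w N) (fun i => Z N i ω) k (θhat N ω k)) u v =
        bil (localHess loss (w N) (fun i => Z N i ω) k (θhat N ω k)) v u := fun k u v =>
    bil_localHess_symm hsm (hball k) u v
  have hlow : ∀ k, ∀ v : Vec p,
      c * ‖v‖ ^ 2 ≤ bil (localHess loss (w N) (fun i => Z N i ω) k (θhat N ω k)) v v :=
    fun k v => by
      have h1 := (abs_le.1 (hdiff k v v)).1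
      have h2 := (hbd N k).1 v
      have h3 : c₀ * ‖v‖ ^ 2 = c * ‖v‖ ^ 2 + c * (‖v‖ * ‖v‖) := by rw [hc_def]; ring
      linarith
  refine ⟨hsymm, hlow, fun k u v => ?_, ?_⟩
  · have h1 := abs_bil_le (infoMatrix loss (ν k) θ₀) u v ((hbd N k).2.1)
    have h2 := abs_sub_abs_le_abs_sub
      (bil (localHess loss (w N) (fun i => Z N i ω) k (θhat N ω k)) u v)
      (bil (infoMatrix loss (ν k) θ₀) u v)
    have h3 := hdiff k u v
    calc _ ≤ (p : ℝ) ^ 2 * D * ‖u‖ * ‖v‖ + c * (‖u‖ * ‖v‖) := by linarith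
      _ = _ := by ring
  · have hw := norm_wlse_sub_le (θ₀ := θ₀) (b := b)
      (fun k i => workerMean (w N) (fun i => Z N i ω) k (fun x => dLoss loss θ₀ x i))
      hN hc hb.le hsymm hlow
      (fun k v => (abs_bil_localHess_add_score_le hsm (hball k) hΘ (hmin k).2 v).trans
        (mul_le_mul_of_nonneg_right (hbound k) (by positivity)))
      (fun k => by
        calc b * ‖θhat N ω k - θ₀‖ ≤ b * (c₀ / (4 * b)) := by
              gcongr; exact (hcl k).le.trans (min_le_right _ _)
          _ = c / 2 := by rw [hc_def]; field_simp; norm_num)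
    refine hw.trans ?_
    simp_rw [sum_workerWeight_mul_workerMean (w N) (fun i => Z N i ω) fun k => (hsize N hN k).1]
    calc _ ≤ c⁻¹ * (∑ _i : Fin p, κ / A * critRate N +
          b * (4 / c ^ 2) * (p * ∑ _i : Fin p, κ / A * critRate N)) := by
          gcongr with i _ i _
          · exact hmean i
          · exact hsq i
      _ = A * (κ / A * critRate N) := by simp [hA_def]; ring
      _ = κ * critRate N := by field_simp

end Uniform

/-! ### Selection consistency -/

lemma tendsto_critRate : Tendsto critRate atTop (𝓝 0) := by
  have h : Tendsto (fun x : ℝ => Real.log x / x) atTop (𝓝 0) := by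
    simpa using Real.tendsto_pow_log_div_mul_add_atTop 1 0 1 one_ne_zero
  have h2 := (Real.continuous_sqrt.tendsto 0).comp (h.comp tendsto_natCast_atTop_atTop)
  rw [Real.sqrt_zero] at h2
  exact h2

section Selection

variable {p d₀ : ℕ} {Ω : Type*} [MeasurableSpace Ω] {P : Measure Ω} [IsProbabilityMeasure P]
  {K : ℕ → ℕ} {w : (N : ℕ) → Fin N → Fin (K N)} {Z : (N : ℕ) → Fin N → Ω → Obs p}
  {ν : ℕ → Measure (Obs p)} [∀ k, IsProbabilityMeasure (ν k)]
  {loss : Vec p → Obs p → ℝ} {Θ : Set (Vec p)} {θ₀ : Vec p}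
  {M : Fin p → Fin p → Fin p → Obs p → ℝ}

/-- With probability tending to one, the criterion separates the reference estimate from all
estimates with a wrong model. -/
lemma highProb_dbic_separation (hd₀ : 0 < d₀) (hd₀p : d₀ < p)
    (hθ₀ : ∀ j : Fin p, θ₀ j ≠ 0 ↔ (j : ℕ) < d₀) (hW : CondWorkers K w)
    (hC1 : CondParameterSpace Θ θ₀) (hC2 : CondSampling P K w Z ν)
    (hC3 : CondIdentifiable P K w Z ν loss Θ θ₀) (hC4 : CondLocalConvexity ν loss θ₀)
    (hC5 : CondSmooth ν loss Θ θ₀ M) (hU : CondUniform K ν loss θ₀ M)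
    {θhat : (N : ℕ) → Ω → Fin (K N) → Vec p}
    (hθhat : ∀ N, ∀ᵐ ω ∂P, ∀ k, θhat N ω k ∈ Θ ∧
      IsMinOn (localLoss loss (w N) (fun i => Z N i ω) k) Θ (θhat N ω k))
    {est : (N : ℕ) → Ω → (Fin p → ℝ) → Vec p}
    (hest : ∀ N, ∀ᵐ ω ∂P, ∀ lam : Fin p → ℝ,
      (∃ θ, IsMinOn (lassoObj loss (w N) (fun i => Z N i ω) (θhat N ω) lam) Set.univ θ) →
      IsMinOn (lassoObj loss (w N) (fun i => Z N i ω) (θhat N ω) lam) Set.univ (est N ω lam)) :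
    HighProb P fun N ω =>
      dbic loss (w N) (fun i => Z N i ω) (θhat N ω) (est N ω (refTuning p d₀ N)) <
        critRate N ^ 2 * (d₀ + 1) ∧
      ∀ θ, model θ ≠ trueModel p d₀ →
        critRate N ^ 2 * (d₀ + 1) ≤ dbic loss (w N) (fun i => Z N i ω) (θhat N ω) θ := by
  obtain ⟨c, C, hc, hC, hfit⟩ := exists_highProb_wlse (hd₀.trans hd₀p) hW hC1 hC2 hC3 hC4 hC5 hU
    hθhat
  obtain ⟨β, hβ0, hβ⟩ : ∃ β > 0, ∀ j : Fin p, (j : ℕ) < d₀ → β ≤ |θ₀ j| := by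
    obtain ⟨j, hj, hmin⟩ := Finset.exists_min_image (trueModel p d₀) (fun j => |θ₀ j|)
      ⟨⟨0, hd₀.trans hd₀p⟩, by simp [trueModel, hd₀]⟩
    exact ⟨|θ₀ j|, abs_pos.2 ((hθ₀ j).2 (by simpa [trueModel] using hj)),
      fun i hi => hmin i (by simpa [trueModel] using hi)⟩
  -- Chosen so that C κ² ≤ 1/4; any smaller positive value would do, as θ̃ - θ₀ is o(r).
  set κ : ℝ := 1 / (2 * (C + 1)) with hκ_def
  have hκ : 0 < κ := by positivity
  have hCκ : C * κ ^ 2 ≤ 1 / 4 := by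
    rw [hκ_def, div_pow, one_pow, mul_one_div, div_le_div_iff₀ (by positivity) (by norm_num)]
    nlinarith
  have hr1 : ∀ᶠ N in atTop, κ * critRate N ≤ β / 2 := by
    have h : Tendsto (fun N => κ * critRate N) atTop (𝓝 0) := by
      simpa using tendsto_critRate.const_mul κ
    exact h.eventually_le_const (by positivity)
  have hr2 : ∀ᶠ N in atTop, critRate N ^ 2 * (d₀ + 1) ≤ c * (β / 2) ^ 2 := by
    have h : Tendsto (fun N => critRate N ^ 2 * ((d₀ : ℝ) + 1)) atTop (𝓝 0) := by
      simpa using (tendsto_critRate.pow 2).mul_const ((d₀ : ℝ) + 1)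
    exact h.eventually_le_const (by positivity)
  have hl1 : ∀ᶠ N : ℕ in atTop, ∑ j, |θ₀ j| ≤ Real.log N / 4 :=
    (tendsto_log_natCast.atTop_div_const (by norm_num)).eventually_ge_atTop _
  have hl2 : ∀ᶠ N : ℕ in atTop, 3 * C * Real.sqrt c⁻¹ + C * κ < Real.sqrt (Real.log N) :=
    (Real.tendsto_sqrt_atTop.comp tendsto_log_natCast).eventually_gt_atTop _
  refine (hfit κ hκ).mono ?_
  filter_upwards [hr1, hr2, hl1, hl2, eventually_gt_atTop 1] with N hr1 hr2 hl1 hl2 hN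
  filter_upwards [hest N] with ω hestω
  rintro ⟨hsymm, hlow, hup, hw⟩
  have hN0 : 0 < N := by omega
  have hS := bil_precision_ge hN0 hlow
  have hunit := isUnit_of_bil_ge hc hS
  refine ⟨?_, fun θ hθ => dbic_ge_of_model_ne hd₀p hN0 hc hS hβ hβ0 (hw.trans hr1) hr2 hθ⟩
  -- By `lsLoss_eq` the two objectives differ by a constant, so they have the same minimizers.
  have hobj : ∀ θ, IsMinOn (lassoObj loss (w N) (fun i => Z N i ω) (θhat N ω)
      (refTuning p d₀ N)) Set.univ θ ↔
      IsMinOn (fun θ => quadForm (precision loss (w N) (fun i => Z N i ω) (θhat N ω))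
        (θ - wlse loss (w N) (fun i => Z N i ω) (θhat N ω)) +
        ∑ j, refTuning p d₀ N j * |θ j|) Set.univ θ := fun θ => by
    have e : ∀ x, lassoObj loss (w N) (fun i => Z N i ω) (θhat N ω) (refTuning p d₀ N) x =
        quadForm (precision loss (w N) (fun i => Z N i ω) (θhat N ω))
          (x - wlse loss (w N) (fun i => Z N i ω) (θhat N ω)) +
          ∑ j, refTuning p d₀ N j * |x j| + lsLoss loss (w N) (fun i => Z N i ω) (θhat N ω)
            (wlse loss (w N) (fun i => Z N i ω) (θhat N ω)) := fun x => by
      rw [lassoObj, lsLoss_eq hunit hsymm, add_right_comm]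
    simp only [isMinOn_iff, e, add_le_add_iff_right]
  have hmin := (hobj _).1 (hestω (refTuning p d₀ N) ((exists_congr hobj).2
    (exists_isMinOn_penalized hc hS (refTuning_nonneg p d₀ N) _)))
  refine dbic_le_of_isMinOn_refTuning hd₀p hN hc hC.le hκ.le (fun u v => ?_) hS
    (abs_bil_precision_le hN0 hup) (fun j hj => not_not.1 (mt (hθ₀ j).1 hj)) hw hCκ hl1 hl2 hmin
  simp only [bil_precision, hsymm _ u v]

end Selection

end DLSA

theorem theorem4
    {p d₀ : ℕ} (hd₀ : 0 < d₀) (hd₀p : d₀ < p)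
    {Ω : Type*} [MeasurableSpace Ω] (P : Measure Ω) [IsProbabilityMeasure P]
    -- workers, data, and the law of an observation on each worker
    (K : ℕ → ℕ) (w : (N : ℕ) → Fin N → Fin (K N)) (Z : (N : ℕ) → Fin N → Ω → DLSA.Obs p)
    (ν : ℕ → Measure (DLSA.Obs p)) [∀ k, IsProbabilityMeasure (ν k)]
    -- loss function, parameter space, true value
    (loss : DLSA.Vec p → DLSA.Obs p → ℝ) (Θ : Set (DLSA.Vec p)) (θ₀ : DLSA.Vec p)
    (hθ₀ : ∀ j : Fin p, θ₀ j ≠ 0 ↔ (j : ℕ) < d₀)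
    (M : Fin p → Fin p → Fin p → DLSA.Obs p → ℝ)
    (hW : DLSA.CondWorkers K w)
    (hC1 : DLSA.CondParameterSpace Θ θ₀)
    (hC2 : DLSA.CondSampling P K w Z ν)
    (hC3 : DLSA.CondIdentifiable P K w Z ν loss Θ θ₀)
    (hC4 : DLSA.CondLocalConvexity ν loss θ₀)
    (hC5 : DLSA.CondSmooth ν loss Θ θ₀ M)
    (hU : DLSA.CondUniform K ν loss θ₀ M)
    -- the local estimators
    (θhat : (N : ℕ) → Ω → Fin (K N) → DLSA.Vec p)
    (hθhat : ∀ N, ∀ᵐ ω ∂P, ∀ k, θhat N ω k ∈ Θ ∧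
      IsMinOn (DLSA.localLoss loss (w N) (fun i => Z N i ω) k) Θ (θhat N ω k))
    -- the shrinkage estimators: a minimizer of the adaptive Lasso objective wherever there is one
    (est : (N : ℕ) → Ω → (Fin p → ℝ) → DLSA.Vec p)
    (hest : ∀ N, ∀ᵐ ω ∂P, ∀ lam : Fin p → ℝ,
      (∃ θ, IsMinOn (DLSA.lassoObj loss (w N) (fun i => Z N i ω) (θhat N ω) lam) Set.univ θ) →
      IsMinOn (DLSA.lassoObj loss (w N) (fun i => Z N i ω) (θhat N ω) lam) Set.univ
        (est N ω lam)) :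
    -- the infimum of the criterion over all wrong models exceeds its reference value
    DLSA.HighProb P (fun N ω =>
      ((DLSA.dbic loss (w N) (fun i => Z N i ω) (θhat N ω)
          (est N ω (DLSA.refTuning p d₀ N)) : ℝ) : EReal) <
        ⨅ lam ∈ DLSA.underfitted d₀ (est N ω) ∪ DLSA.overfitted d₀ (est N ω),
          ((DLSA.dbic loss (w N) (fun i => Z N i ω) (θhat N ω) (est N ω lam) : ℝ) : EReal)) ∧
    -- minimizing the criterion over tuning parameters that include the reference one selects
    -- the true model
    DLSA.HighProb P (fun N ω =>
      ∀ Λ : Set (Fin p → ℝ), DLSA.refTuning p d₀ N ∈ Λ → ∀ lam ∈ Λ,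
        IsMinOn (fun l => DLSA.dbic loss (w N) (fun i => Z N i ω) (θhat N ω) (est N ω l)) Λ lam →
        DLSA.model (est N ω lam) = DLSA.trueModel p d₀) := by
  have hsep := DLSA.highProb_dbic_separation hd₀ hd₀p hθ₀ hW hC1 hC2 hC3 hC4 hC5 hU hθhat hest
  constructor
  · refine hsep.mono (Eventually.of_forall fun N => Eventually.of_forall fun ω hω => ?_)
    -- The threshold is a lower bound for the whole family, so the strict inequality survives the
    -- infimum; an empty family gives `⊤`.
    refine (EReal.coe_lt_coe_iff.2 hω.1).trans_le (le_iInf₂ fun lam hlam => ?_)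
    refine EReal.coe_le_coe_iff.2 (hω.2 _ fun h => ?_)
    rcases hlam with hlam | hlam
    · exact hlam h.ge
    · exact hlam.2 h
  · refine hsep.mono (Eventually.of_forall fun N => Eventually.of_forall fun ω hω => ?_)
    intro Λ href lam _ hmin
    by_contra hne
    -- A minimizer with a wrong model would have a value at or above the threshold, hence above the
    -- value at the reference tuning.
    exact absurd (hmin href) (not_le.2 (hω.1.trans_le (hω.2 _ hne)))
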